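/- For real matrices $A\in\mathbb R^{I\times R}$, $B\in\mathbb R^{J\times R}$, $C\in\mathbb R^{K\times R}$ with columns $a_r,b_r,c_r$ write $[A,B,C]_R=\sum_{r=1}^R a_r\circ b_r\circ c_r\in\mathbb R^{I\times J\times K}$, where $(a\circ b\circ c)_{ijk}=a_ib_jc_k$. The rank $r_{\mathcal T}$ of a tensor $\mathcal T\in\mathbb R^{I\times J\times K}$ is the least $R$ such that $\mathcal T=[A,B,C]_R$ for some $A,B,C$; such a representation with $R=r_{\mathcal T}$ is a canonical polyadic decomposition (CPD) of $\mathcal T$. The CPD of $\mathcal T$ is unique if any two CPDs of $\mathcal T$ agree up to a permutation of the $R$ terms and a rescaling of the three vectors within each term by factors with product $1$. The $k$-rank $k_C$ is the largest $k\le R$ such that every $k$ columns of $C$ are linearly independent. The compound matrix $\mathcal C_n(A)$ is the matrix of all $n\times n$ minors of $A$; $\odot$ is the Khatri–Rao (columnwise Kronecker) product; a matrix has full column rank if its columns are linearly independent. A class of $I\times J\times K$ tensors of rank $R$ has CPDs that *can be found algebraically* if there are a number $N$ and one finite procedure which, for every tensor $\mathcal T$ of the class and for almost every (Lebesgue) choice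 of generic parameters $\rho\in\mathbb R^N$ (random mixing coefficients), started with the entries of $\mathcal T$ and with $\rho$, runs without error and returns matrices $A,B,C$ with $R$ columns such that $[A,B,C]_R$ is a CPD of $\mathcal T$. The steps of a procedure are: evaluating polynomials with rational coefficients in the matrix entries computed so far (this includes sums and products of matrices, Khatri–Rao products and compound matrices); inverting a nonsingular matrix; computing a basis of the orthogonal complement of the column space of a matrix; computing a generalized eigenvalue decomposition of a regular square pencil $(M,N)$ that has one over $\mathbb R$, that is, a nonsingular $V=[v_1\ \cdots\ v_p]$ and pairs $(\alpha_r,\beta_r)\ne(0,0)$ with $\beta_rMv_r=\alpha_rNv_r$; and branching on whether a computed number is zero. The procedure has to succeed whichever basis and whichever generalized eigenvalue decomposition these steps return. **Theorem 1.7.** Let $I,J,K,R,k$ be given with $k\le R+2$, let $n:=R-k+2$, and assume $n\le R$ (that is, $k\ge2$, so that the $n$-th compound of a matrix with $R$ columns has at least one column). Consider the matrices $A\in\mathbb R^{I\times R}$, $B\in\mathbb R^{J\times R}$, $C\in\mathbb R^{K\times R}$ such that $$k_C=k\quad\text{and}\quad \mathcal C_n(A)\odot\mathcal C_n(B)\ \text{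 has full column rank.}$$ (i) For all such $A,B,C$ the tensor $\mathcal T=[A,B,C]_R$ has rank $r_{\mathcal T}=R$, and its CPD is unique. (ii) The CPDs of the tensors $\mathcal T=[A,B,C]_R$ with such $A,B,C$ can be found algebraically, by one procedure that depends only on $I,J,K,R$ and $k$. -/

import Mathlib

noncomputable section

/-! ### Matrices: k-rank, compound matrices, Khatri–Rao product -/

/-- A matrix has full column rank if its columns are linearly independent. -/
def FullColumnRank {α β : Type} (M : Matrix α β ℝ) : Prop :=
  LinearIndependent ℝ M.col

/-- The `k`-rank of a matrix with `R` columns: the largest `k ≤ R` such that every subset of `k`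
columns is linearly independent. (The set below contains `0` and is bounded by `R`.) -/
def kRank {m R : ℕ} (M : Matrix (Fin m) (Fin R) ℝ) : ℕ :=
  sSup {k : ℕ | k ≤ R ∧
    ∀ S : Finset (Fin R), S.card = k → LinearIndependent ℝ (fun r : S => M.col r)}

/-- The `k`-th compound matrix: its entries are the `k × k` minors, the rows and columns being
labelled by the increasing `k`-tuples of row and column indices. -/
def compound {m n : ℕ} (k : ℕ) (M : Matrix (Fin m) (Fin n) ℝ) :
    Matrix (Fin k ↪o Fin m) (Fin k ↪o Fin n) ℝ :=
  Matrix.of fun s t => (M.submatrix s t).det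

/-- The Khatri–Rao product: the `r`-th column of `M ⊙ N` is the Kronecker product of the `r`-th
column of `M` and the `r`-th column of `N`. -/
def khatriRao {α β γ : Type} (M : Matrix α γ ℝ) (N : Matrix β γ ℝ) : Matrix (α × β) γ ℝ :=
  Matrix.of fun p r => M p.1 r * N p.2 r

/-! ### Third-order tensors and their canonical polyadic decomposition -/

/-- Real `I × J × K` tensors. -/
abbrev Tensor (I J K : ℕ) : Type := Fin I → Fin J → Fin K → ℝ

/-- The tensor `[A, B, C]_R = ∑ r, a_r ∘ b_r ∘ c_r`. -/
def cpTensor {I J K R : ℕ} (A : Matrix (Fin I) (Fin R) ℝ) (B : Matrix (Fin J) (Fin R) ℝ)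
    (C : Matrix (Fin K) (Fin R) ℝ) : Tensor I J K :=
  fun i j k => ∑ r, A i r * B j r * C k r

/-- The rank of a tensor: the least number of terms in a polyadic decomposition. (Allowing zero
terms does not change the minimum.) -/
def tensorRank {I J K : ℕ} (T : Tensor I J K) : ℕ :=
  sInf {R : ℕ | ∃ (A : Matrix (Fin I) (Fin R) ℝ) (B : Matrix (Fin J) (Fin R) ℝ)
    (C : Matrix (Fin K) (Fin R) ℝ), cpTensor A B C = T}

/-- `[A, B, C]_R` is a canonical polyadic decomposition of `T`: it equals `T`, and the number `R`
of its terms is minimal. -/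
def IsCPD {I J K R : ℕ} (A : Matrix (Fin I) (Fin R) ℝ) (B : Matrix (Fin J) (Fin R) ℝ)
    (C : Matrix (Fin K) (Fin R) ℝ) (T : Tensor I J K) : Prop :=
  cpTensor A B C = T ∧ tensorRank T = R

/-- `[A', B', C']_R` arises from `[A, B, C]_R` by permuting the terms and rescaling the vectors
within each term in such a way that the term itself does not change. -/
def CPDEquiv {I J K R : ℕ} (A : Matrix (Fin I) (Fin R) ℝ) (B : Matrix (Fin J) (Fin R) ℝ)
    (C : Matrix (Fin K) (Fin R) ℝ) (A' : Matrix (Fin I) (Fin R) ℝ) (B' : Matrix (Fin J) (Fin R) ℝ)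
    (C' : Matrix (Fin K) (Fin R) ℝ) : Prop :=
  ∃ (π : Equiv.Perm (Fin R)) (a b c : Fin R → ℝ), ∀ r,
    a r * b r * c r = 1 ∧ A'.col r = a r • A.col (π r) ∧ B'.col r = b r • B.col (π r) ∧
      C'.col r = c r • C.col (π r)

/-- The CPD of `T` is unique: any two CPDs of `T` differ only by the trivial indeterminacies. -/
def CPDUnique {I J K : ℕ} (T : Tensor I J K) : Prop :=
  ∀ (R : ℕ) (A A' : Matrix (Fin I) (Fin R) ℝ) (B B' : Matrix (Fin J) (Fin R) ℝ)
    (C C' : Matrix (Fin K) (Fin R) ℝ),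
    IsCPD A B C T → IsCPD A' B' C' T → CPDEquiv A B C A' B' C'

/-! ### Algebraic computations -/

/-- The columns of `N` form a basis of the orthogonal complement of the column space of `M`. -/
def IsOrthComplBasis {m n d : ℕ} (M : Matrix (Fin m) (Fin n) ℝ) (N : Matrix (Fin m) (Fin d) ℝ) :
    Prop :=
  LinearIndependent ℝ N.col ∧
    ∀ v : Fin m → ℝ, v ∈ Submodule.span ℝ (Set.range N.col) ↔ ∀ j, M.col j ⬝ᵥ v = 0

/-- A generalized eigenvalue decomposition of the regular pencil `(M, N)`: the columns `v_r` of the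
nonsingular matrix `V` are generalized eigenvectors, `b_r M v_r = a_r N v_r`, the generalized
eigenvalue `a_r / b_r` being given by the pair `(a_r, b_r) ≠ (0, 0)` in row `r` of `E`. -/
def IsGEVD {p : ℕ} (M N V : Matrix (Fin p) (Fin p) ℝ) (E : Matrix (Fin p) (Fin 2) ℝ) : Prop :=
  (∃ s t : ℝ, (s • M + t • N).det ≠ 0) ∧ V.det ≠ 0 ∧
    ∀ r, (E r 0 ≠ 0 ∨ E r 1 ≠ 0) ∧ E r 1 • M.mulVec (V.col r) = E r 0 • N.mulVec (V.col r)

/-- A memory cell `(x, i, j)` is the entry `(i, j)` of the matrix register `x`. -/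
abbrev Cell : Type := ℕ × ℕ × ℕ

/-- The memory: the contents of every cell. -/
abbrev Memory : Type := Cell → ℝ

/-- Overwrite the register `x` by the matrix `M` (padded by zeros). -/
def Memory.write {m n : ℕ} (σ : Memory) (x : ℕ) (M : Matrix (Fin m) (Fin n) ℝ) : Memory :=
  fun c => if c.1 = x then
      (if h : c.2.1 < m ∧ c.2.2 < n then M ⟨c.2.1, h.1⟩ ⟨c.2.2, h.2⟩ else 0)
    else σ c

/-- The upper left `m × n` block of the register `x`. -/
def Memory.read (σ : Memory) (x m n : ℕ) : Matrix (Fin m) (Fin n) ℝ :=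
  Matrix.of fun i j => σ (x, (i : ℕ), (j : ℕ))

/-- Finite algebraic procedures working on real matrices. The matrix arguments of `inverse`,
`orthCompl` and `gevd` are assembled from arbitrary memory cells, so forming submatrices,
transposing, stacking and reshaping need no instruction.
* `skip`, `seq`: do nothing, do one procedure after the other.
* `poly x m n p`: write into register `x` the `m × n` matrix whose entries are the given
  polynomials, with rational coefficients, in the memory cells. This covers sums, products,
  Kronecker and Khatri–Rao products of matrices, determinants and compound matrices.
* `inverse x n M`: write into register `x` the inverse of the square matrix `M`, which must be
  nonsingular (for `n = 1` this is division).
* `orthCompl x m n d M`: write into register `x` a basis of the orthogonal complement of the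
  column space of the `m × n` matrix `M`, which must be of dimension `d`.
* `gevd x y p M N`: write into the registers `x` and `y` the generalized eigenvectors and the
  generalized eigenvalues of the regular pencil `(M, N)` of `p × p` matrices, which must have a
  (real) generalized eigenvalue decomposition.
* `ifZero c P Q`: continue with `P` if the cell `c` contains `0`, and with `Q` otherwise. -/
inductive Procedure : Type
  | skip : Procedure
  | seq (P Q : Procedure) : Procedure
  | poly (x m n : ℕ) (p : Matrix (Fin m) (Fin n) (MvPolynomial Cell ℚ)) : Procedure
  | inverse (x n : ℕ) (M : Matrix (Fin n) (Fin n) Cell) : Procedure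
  | orthCompl (x m n d : ℕ) (M : Matrix (Fin m) (Fin n) Cell) : Procedure
  | gevd (x y p : ℕ) (M N : Matrix (Fin p) (Fin p) Cell) : Procedure
  | ifZero (c : Cell) (P Q : Procedure) : Procedure

/-- `P.Ensures Q σ`: every execution of the procedure `P` from the memory `σ` runs without error
and ends in a memory that satisfies `Q`. The operations `orthCompl` and `gevd` fail if there is no
valid result of the prescribed format; otherwise they may return any valid result, and the procedure
has to work whichever is returned. -/
def Procedure.Ensures : Procedure → (Memory → Prop) → Memory → Prop
  | .skip, Q, σ => Q σ
  | .seq P P', Q, σ => P.Ensures (P'.Ensures Q) σ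
  | .poly x _ _ p, Q, σ => Q (σ.write x (p.map (MvPolynomial.aeval σ)))
  | .inverse x _ M, Q, σ => (M.map σ).det ≠ 0 ∧ Q (σ.write x (M.map σ)⁻¹)
  | .orthCompl x m _ d M, Q, σ =>
      (∃ N : Matrix (Fin m) (Fin d) ℝ, IsOrthComplBasis (M.map σ) N) ∧
        ∀ N : Matrix (Fin m) (Fin d) ℝ, IsOrthComplBasis (M.map σ) N → Q (σ.write x N)
  | .gevd x y _ M N, Q, σ =>
      (∃ V E, IsGEVD (M.map σ) (N.map σ) V E) ∧
        ∀ V E, IsGEVD (M.map σ) (N.map σ) V E → Q ((σ.write x V).write y E)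
  | .ifZero c P P', Q, σ => (σ c = 0 → P.Ensures Q σ) ∧ (σ c ≠ 0 → P'.Ensures Q σ)

/-- The initial memory: the registers `0, …, K - 1` hold the frontal slices of the tensor `T`, the
register `K` holds, as a column, the real parameters `ρ`, and all other cells are `0`. -/
def Memory.start {I J K N : ℕ} (T : Tensor I J K) (ρ : Fin N → ℝ) : Memory :=
  fun c =>
    if hx : c.1 < K then
      (if h : c.2.1 < I ∧ c.2.2 < J then T ⟨c.2.1, h.1⟩ ⟨c.2.2, h.2⟩ ⟨c.1, hx⟩ else 0)
    else if h : c.1 = K ∧ c.2.1 < N ∧ c.2.2 = 0 then ρ ⟨c.2.1, h.2.1⟩ else 0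

/-- The CPDs of the tensors in the class `𝒯`, all of rank `R`, can be found algebraically: there is
one procedure, which may use finitely many generic real parameters `ρ` (random mixing coefficients),
such that for every tensor `T` in `𝒯` and almost every `ρ`, the procedure, started with the slices
of `T` and with `ρ`, runs without error and ends with the three factor matrices of a CPD of `T` in
the registers `0`, `1`, `2`. -/
def CPDFoundAlgebraically (I J K R : ℕ) (𝒯 : Set (Tensor I J K)) : Prop :=
  ∃ (N : ℕ) (P : Procedure), ∀ T ∈ 𝒯, ∀ᵐ ρ : Fin N → ℝ,
    P.Ensures (fun σ => IsCPD (σ.read 0 I R) (σ.read 1 J R) (σ.read 2 K R) T) (Memory.start T ρ)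

end

noncomputable section

open Finset Matrix MeasureTheory

/-! ### Minors -/

/-! Write k = h + 1 and n = p + 1, so that p + h = R. Mixing the slices of the tensor by a vector y
gives the matrix ∑ d_r a_r b_rᵀ with d = yᵀC (`diagForm`). By Cauchy–Binet its n-minors are
combinations of the n-fold products of the d_r, with the entries of 𝒞_n(A) ⊙ 𝒞_n(B) as coefficients;
full column rank makes them all vanish exactly when at most p of the d_r are nonzero
(`FullColumnRank.card_lt_of_minors`). A generic compression of C to h + 1 rows keeps every h + 1
columns independent (`ae_goodMix`). Then a nonzero y is orthogonal to at most h columns, and for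
each p-element set Ω of columns there is, up to scale, one point x_Ω orthogonal to exactly the h
columns outside Ω.

Uniqueness. In a second decomposition with R terms, a y orthogonal to h columns of C' gives a slice
with at most p terms, hence is orthogonal to exactly h columns of C (`card_zeros_eq`). Kruskal's
permutation lemma (`exists_perm_vecMul_eq`) then matches the compressed columns. A bordered minor
built from two slices with few terms is a multiple of a single column of A
(`borderedMinor_diagForm`), which matches A' with A and, by transposition, B' with B; the third
factor follows because A ⊙ B has independent columns. A shorter decomposition, padded by zero terms,
would contradict this, so the rank is R.

Algebraic computation. The n-minors of the mixed slice are forms of degree p + 1 in y, and the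
symmetric tensors that annihilate all of them are spanned by the powers of order p + 1 of the points
(`mem_span_moment_iff`). This rests on the equality of the number of sets Ω with the number of
monomials of degree p in h + 1 variables. Contracting any basis of this kernel with two random
vectors yields a pencil whose generalized eigenvectors reveal the points (`gevd_findsPoints`).
Bordered minors then give A and B up to scale, and least squares gives C. Which eigenvectors and
minors to use depends on the data, so all finitely many choices are tried and tested
(`tryChoices_ensures`). -/

theorem exists_orderEmbedding_comp_perm {n R : ℕ} {f : Fin n → Fin R} (hf : Function.Injective f) :
    ∃ (Θ : Fin n ↪o Fin R) (σ : Equiv.Perm (Fin n)), f = Θ ∘ σ := by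
  have hm : StrictMono (f ∘ Tuple.sort f) :=
    (Tuple.monotone_sort f).strictMono_of_injective (hf.comp (Equiv.injective _))
  refine ⟨OrderEmbedding.ofStrictMono _ hm, (Tuple.sort f)⁻¹, ?_⟩
  ext i
  simp

/-- The Cauchy–Binet formula. -/
theorem det_mul_eq_sum_orderEmbedding {n R : ℕ} {S : Type*} [CommRing S]
    (P : Matrix (Fin n) (Fin R) S) (Q : Matrix (Fin R) (Fin n) S) :
    (P * Q).det = ∑ Θ : Fin n ↪o Fin R, (P.submatrix id Θ).det * (Q.submatrix Θ id).det := by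
  have h1 : (P * Q).det = ∑ f : Fin n → Fin R, (∏ i, P i (f i)) * (Q.submatrix f id).det := by
    have : P * Q = fun i => ∑ r, P i r • Q r := by
      ext i j
      simp [Matrix.mul_apply]
    rw [this]
    change detRowAlternating.toMultilinearMap (fun i => ∑ r, P i r • Q r) = _
    -- Expanding each row in the rows of Q gives a sum over all maps, not only the increasing ones.
    rw [MultilinearMap.map_sum]
    refine Finset.sum_congr rfl fun f _ => ?_
    rw [MultilinearMap.map_smul_univ]
    rfl
  have h2 : ∀ Θ : Fin n ↪o Fin R, (P.submatrix id Θ).det * (Q.submatrix Θ id).det =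
      ∑ σ : Equiv.Perm (Fin n), (∏ i, P i (Θ (σ i))) * (Q.submatrix (Θ ∘ σ) id).det := by
    intro Θ
    rw [← det_transpose, det_apply', Finset.sum_mul]
    refine Finset.sum_congr rfl fun σ _ => ?_
    have : Q.submatrix (Θ ∘ σ) id = (Q.submatrix Θ id).submatrix σ id := rfl
    rw [this, det_permute]
    simp only [transpose_apply, submatrix_apply, id_eq]
    ring
  rw [h1, Finset.sum_congr rfl fun Θ _ => h2 Θ, ← Fintype.sum_prod_type']
  symm
  -- Pairs (Θ, σ) enumerate the injective maps; any other map repeats a row of Q and contributes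
  -- zero.
  refine Finset.sum_of_injOn (fun q : (Fin n ↪o Fin R) × Equiv.Perm (Fin n) => q.1 ∘ q.2)
    ?_ (fun _ _ => by simp) ?_ (fun _ _ => rfl)
  · rintro ⟨Θ, σ⟩ - ⟨Θ', σ'⟩ - h
    simp only at h
    have hr : Set.range Θ = Set.range Θ' := by
      rw [← σ.surjective.range_comp Θ, h, σ'.surjective.range_comp]
    have hΘ : Θ = Θ' := by
      apply DFunLike.coe_injective
      exact (StrictMono.range_inj Θ.strictMono Θ'.strictMono).1 hr
    subst hΘ
    congr 1
    ext i
    have := congrFun h i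
    simp only [Function.comp_apply, EmbeddingLike.apply_eq_iff_eq] at this
    rw [this]
  · intro f _ hf
    by_cases hi : Function.Injective f
    · obtain ⟨Θ, σ, rfl⟩ := exists_orderEmbedding_comp_perm hi
      exact absurd ⟨(Θ, σ), by simp, rfl⟩ hf
    · obtain ⟨i, j, hij, hne⟩ : ∃ i j, f i = f j ∧ i ≠ j := by
        simpa [Function.Injective] using hi
      rw [det_zero_of_row_eq hne (by ext l; simp [hij]), mul_zero]

/-- The matrix `∑ r, d r • (a_r ∘ b_r)`. -/
def diagForm {I J R : ℕ} (A : Matrix (Fin I) (Fin R) ℝ) (B : Matrix (Fin J) (Fin R) ℝ)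
    (d : Fin R → ℝ) : Matrix (Fin I) (Fin J) ℝ :=
  Matrix.of fun i j => ∑ r, A i r * B j r * d r

section
variable {I J R : ℕ} (A : Matrix (Fin I) (Fin R) ℝ) (B : Matrix (Fin J) (Fin R) ℝ) (d : Fin R → ℝ)

theorem det_diagForm_submatrix {n : ℕ} (s : Fin n → Fin I) (t : Fin n → Fin J) :
    ((diagForm A B d).submatrix s t).det =
      ∑ Θ : Fin n ↪o Fin R,
        (A.submatrix s Θ).det * (B.submatrix t Θ).det * ∏ i, d (Θ i) := by
  have : (diagForm A B d).submatrix s t =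
      (Matrix.of fun i r => d r * A (s i) r) * (B.submatrix t id)ᵀ := by
    ext i j
    simp only [diagForm, submatrix_apply, of_apply, mul_apply, transpose_apply, id_eq]
    exact Finset.sum_congr rfl fun r _ => by ring
  rw [this, det_mul_eq_sum_orderEmbedding]
  refine Finset.sum_congr rfl fun Θ _ => ?_
  have h1 : ((Matrix.of fun i r => d r * A (s i) r).submatrix id Θ) =
      Matrix.of fun i j => (d (Θ j)) * (A.submatrix s Θ) i j := rfl
  have h2 : ((B.submatrix t id)ᵀ.submatrix Θ id) = (B.submatrix t Θ)ᵀ := rfl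
  rw [h1, h2, det_transpose, det_mul_row]
  ring

/-- Only the q terms in the range of f survive, so the matrix factors through those columns and no
sum over column sets is needed. -/
theorem diagForm_submatrix_eq_mul {m n q : ℕ} {f : Fin q → Fin R} (hf : Function.Injective f)
    (hd : ∀ r, r ∉ Set.range f → d r = 0) (s : Fin m → Fin I) (t : Fin n → Fin J) :
    (diagForm A B d).submatrix s t =
      (Matrix.of fun i j => A (s i) (f j) * d (f j)) * (B.submatrix t f)ᵀ := by
  ext i j
  simp only [diagForm, submatrix_apply, of_apply, mul_apply, transpose_apply]
  symm
  refine Fintype.sum_of_injective f hf _ _ (fun r hr => by simp [hd r hr]) fun l => by ring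

theorem det_diagForm_submatrix_of_support {n : ℕ} {f : Fin n → Fin R} (hf : Function.Injective f)
    (hd : ∀ r, r ∉ Set.range f → d r = 0) (s : Fin n → Fin I) (t : Fin n → Fin J) :
    ((diagForm A B d).submatrix s t).det =
      (A.submatrix s f).det * (B.submatrix t f).det * ∏ i, d (f i) := by
  rw [diagForm_submatrix_eq_mul A B d hf hd, det_mul, det_transpose]
  have : (Matrix.of fun i j => A (s i) (f j) * d (f j)) =
      Matrix.of fun i j => d (f j) * (A.submatrix s f) i j := by
    ext i j; simp [mul_comm]
  rw [this, det_mul_row]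
  ring
end

theorem exists_eq_zero_of_card_lt {n R : ℕ} {d : Fin R → ℝ} (h : #{r | d r ≠ 0} < n)
    {f : Fin n → Fin R} (hf : Function.Injective f) : ∃ i, d (f i) = 0 := by
  by_contra! hne
  have : #(univ.map ⟨f, hf⟩) ≤ #{r | d r ≠ 0} := by
    apply card_le_card
    intro r
    simp only [Finset.mem_map, Function.Embedding.coeFn_mk, mem_filter_univ]
    rintro ⟨i, -, rfl⟩
    exact hne i
  rw [card_map, card_univ, Fintype.card_fin] at this
  omega

theorem det_diagForm_submatrix_eq_zero {I J R n : ℕ} (A : Matrix (Fin I) (Fin R) ℝ)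
    (B : Matrix (Fin J) (Fin R) ℝ) {d : Fin R → ℝ} (h : #{r | d r ≠ 0} < n)
    (s : Fin n → Fin I) (t : Fin n → Fin J) : ((diagForm A B d).submatrix s t).det = 0 := by
  rw [det_diagForm_submatrix]
  refine Finset.sum_eq_zero fun Θ _ => ?_
  obtain ⟨i, hi⟩ := exists_eq_zero_of_card_lt h Θ.injective
  rw [Finset.prod_eq_zero (mem_univ i) hi, mul_zero]

/-- Columns of a Khatri–Rao product are linearly independent: coefficient form. -/
theorem FullColumnRank.eq_zero_of_sum {α β γ : Type} [Fintype γ] {M : Matrix α γ ℝ}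
    {N : Matrix β γ ℝ} (h : FullColumnRank (khatriRao M N)) {c : γ → ℝ}
    (hc : ∀ s t, ∑ r, M s r * N t r * c r = 0) : c = 0 := by
  funext r
  refine Fintype.linearIndependent_iff.1 h c ?_ r
  ext ⟨s, t⟩
  simpa [khatriRao, Finset.sum_apply, mul_comm] using hc s t

/-- Every choice of `n` columns admits a nonvanishing minor. -/
def AllMinors {I R : ℕ} (n : ℕ) (A : Matrix (Fin I) (Fin R) ℝ) : Prop :=
  ∀ f : Fin n → Fin R, Function.Injective f → ∃ s : Fin n → Fin I, (A.submatrix s f).det ≠ 0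

/-- Laplace expansion along an added column: a nonzero minor of size n + 1 has a nonzero cofactor on
the columns f. -/
theorem AllMinors.of_succ {I R n : ℕ} {A : Matrix (Fin I) (Fin R) ℝ} (hn : n + 1 ≤ R)
    (h : AllMinors (n + 1) A) : AllMinors n A := by
  intro f hf
  obtain ⟨r, hr⟩ : ∃ r, r ∉ Set.range f := by
    by_contra! hall
    have := Fintype.card_le_of_surjective f hall
    simp at this
    omega
  obtain ⟨s, hs⟩ := h (Fin.cons r f) (Fin.cons_injective_iff.2 ⟨hr, hf⟩)
  rw [det_succ_column_zero] at hs
  obtain ⟨i, -, hi⟩ := Finset.exists_ne_zero_of_sum_ne_zero hs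
  refine ⟨s ∘ i.succAbove, fun h0 => hi ?_⟩
  have : (A.submatrix s (Fin.cons r f)).submatrix i.succAbove Fin.succ =
      A.submatrix (s ∘ i.succAbove) f := by
    ext a b; simp
  rw [this, h0, mul_zero]

theorem AllMinors.mono {I R m n : ℕ} {A : Matrix (Fin I) (Fin R) ℝ} (hn : n ≤ R)
    (h : AllMinors n A) (hm : m ≤ n) : AllMinors m A := by
  induction n, hm using Nat.le_induction with
  | base => exact h
  | succ n _ ih => exact ih (by omega) (h.of_succ hn)

theorem allMinors_of_exists_orderEmbedding {I R n : ℕ} {A : Matrix (Fin I) (Fin R) ℝ}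
    (h : ∀ Θ : Fin n ↪o Fin R, ∃ s : Fin n → Fin I, (A.submatrix s Θ).det ≠ 0) :
    AllMinors n A := by
  intro f hf
  obtain ⟨Θ, σ, rfl⟩ := exists_orderEmbedding_comp_perm hf
  obtain ⟨s, hs⟩ := h Θ
  refine ⟨s, ?_⟩
  have : A.submatrix s (Θ ∘ σ) = (A.submatrix s Θ).submatrix id σ := rfl
  rw [this, det_permute']
  simp [hs]

section
variable {I J R n : ℕ} {A : Matrix (Fin I) (Fin R) ℝ} {B : Matrix (Fin J) (Fin R) ℝ}

theorem FullColumnRank.exists_minor (h : FullColumnRank (khatriRao (compound n A) (compound n B)))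
    (Θ : Fin n ↪o Fin R) : ∃ s t, compound n A s Θ ≠ 0 ∧ compound n B t Θ ≠ 0 := by
  by_contra! hne
  refine LinearIndependent.ne_zero Θ h ?_
  ext ⟨s, t⟩
  simp only [khatriRao, col_apply, of_apply, Pi.zero_apply, mul_eq_zero]
  exact or_iff_not_imp_left.2 (hne s t)

theorem FullColumnRank.allMinors_left
    (h : FullColumnRank (khatriRao (compound n A) (compound n B))) : AllMinors n A :=
  allMinors_of_exists_orderEmbedding fun Θ =>
    let ⟨s, _, hs, _⟩ := h.exists_minor Θ
    ⟨s, hs⟩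

theorem FullColumnRank.allMinors_right
    (h : FullColumnRank (khatriRao (compound n A) (compound n B))) : AllMinors n B :=
  allMinors_of_exists_orderEmbedding fun Θ =>
    let ⟨_, t, _, ht⟩ := h.exists_minor Θ
    ⟨t, ht⟩

/-- If all `n × n` minors of `∑ d_r a_r b_rᵀ` vanish, then fewer than `n` of the `d_r` are
nonzero. -/
theorem FullColumnRank.card_lt_of_minors
    (h : FullColumnRank (khatriRao (compound n A) (compound n B))) {d : Fin R → ℝ}
    (hd : ∀ (s : Fin n → Fin I) (t : Fin n → Fin J), ((diagForm A B d).submatrix s t).det = 0) :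
    #{r | d r ≠ 0} < n := by
  -- The n-fold products of the d_r form a vector in the kernel of 𝒞_n(A) ⊙ 𝒞_n(B).
  have h0 := h.eq_zero_of_sum (c := fun Θ => ∏ i, d (Θ i)) fun s t => by
    have := hd s t
    rw [det_diagForm_submatrix] at this
    exact this
  by_contra! hc
  obtain ⟨S, hS, hcard⟩ := exists_subset_card_eq hc
  have := congrFun h0 (S.orderEmbOfFin hcard)
  rw [Pi.zero_apply, Finset.prod_eq_zero_iff] at this
  obtain ⟨i, -, hi⟩ := this
  have := hS (S.orderEmbOfFin_mem hcard i)
  simp [hi] at this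

/-- `AllMinors` bounds the number of terms of another representation from below. -/
theorem card_support_le_of_diagForm_eq {R' : ℕ} {A' : Matrix (Fin I) (Fin R') ℝ}
    {B' : Matrix (Fin J) (Fin R') ℝ} {d : Fin R → ℝ} {d' : Fin R' → ℝ}
    (hA : AllMinors #{r | d r ≠ 0} A) (hB : AllMinors #{r | d r ≠ 0} B)
    (h : diagForm A B d = diagForm A' B' d') : #{r | d r ≠ 0} ≤ #{r | d' r ≠ 0} := by
  by_contra! hlt
  -- On the support of d the minor is a single nonzero product, while a representation with fewer
  -- terms has no nonzero minor of this size.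
  set f := ({r | d r ≠ 0} : Finset (Fin R)).orderEmbOfFin rfl with hfdef
  have hf := f.injective
  have hr : ∀ r, r ∉ Set.range f → d r = 0 := by
    intro r hr
    rw [hfdef, range_orderEmbOfFin] at hr
    simpa using hr
  obtain ⟨s, hs⟩ := hA f hf
  obtain ⟨t, ht⟩ := hB f hf
  have h1 := det_diagForm_submatrix_of_support A B d hf hr s t
  rw [h, det_diagForm_submatrix_eq_zero A' B' hlt s t] at h1
  refine mul_ne_zero (mul_ne_zero hs ht) (prod_ne_zero_iff.2 fun i _ => ?_) h1.symm
  have := orderEmbOfFin_mem ({r | d r ≠ 0} : Finset (Fin R)) rfl i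
  exact (mem_filter.1 this).2

/-- A relation among the columns of A ⊙ B is a vanishing `diagForm`. Its n-minors vanish, so fewer
than n coefficients are nonzero; on so few columns A and B have nonzero minors, which forces the
support to be empty. -/
theorem FullColumnRank.of_compound (hn : n ≤ R) (hn1 : 1 ≤ n)
    (h : FullColumnRank (khatriRao (compound n A) (compound n B))) :
    FullColumnRank (khatriRao A B) := by
  refine Fintype.linearIndependent_iff.2 fun d hd => ?_
  have h0 : diagForm A B d = diagForm A B 0 := by
    ext i j
    have := congrFun hd (i, j)
    simpa [khatriRao, diagForm, mul_comm, Finset.sum_apply] using this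
  have hlt : #{r | d r ≠ 0} < n := h.card_lt_of_minors fun s t => by
    rw [h0]
    exact det_diagForm_submatrix_eq_zero A B (by simpa using Nat.lt_of_lt_of_le one_pos hn1) s t
  have := card_support_le_of_diagForm_eq (h.allMinors_left.mono hn hlt.le)
    (h.allMinors_right.mono hn hlt.le) h0
  simp only [Pi.zero_apply, ne_eq, not_true_eq_false, filter_false, card_empty, nonpos_iff_eq_zero,
    card_eq_zero, filter_eq_empty_iff, mem_univ, true_implies, not_not] at this
  exact fun i => @this i

/-- A determinant whose value, as a function of the row index `i`, is a multiple of a column of the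
first factor matrix. -/
def borderedMinor {S : Type*} [CommRing S] {I J p : ℕ} (M N : Matrix (Fin I) (Fin J) S)
    (s : Fin p → Fin I) (t : Fin (p + 1) → Fin J) (i : Fin I) : S :=
  (Matrix.of (Fin.cons (fun l => M i (t l)) (fun a l => N (s a) (t l)) :
    Fin (p + 1) → Fin (p + 1) → S)).det

/-- The bordered matrix factors through the columns f. As e vanishes at f 0, the first column of the
left factor is zero below its top entry, and expanding along it leaves i only in A i (f 0). -/
theorem borderedMinor_diagForm {p : ℕ} {d e : Fin R → ℝ} {f : Fin (p + 1) → Fin R}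
    (hf : Function.Injective f) (hd : ∀ r, r ∉ Set.range f → d r = 0)
    (he : ∀ r, r ∉ Set.range (f ∘ Fin.succ) → e r = 0) (s : Fin p → Fin I)
    (t : Fin (p + 1) → Fin J) (i : Fin I) :
    borderedMinor (diagForm A B d) (diagForm A B e) s t i =
      A i (f 0) * (d (f 0) * (A.submatrix s (f ∘ Fin.succ)).det * (∏ j, e (f (Fin.succ j))) *
        (B.submatrix t f).det) := by
  have h0 : e (f 0) = 0 := he _ (by
    rintro ⟨j, hj⟩
    exact Fin.succ_ne_zero j (hf hj))
  have he' : ∀ r, r ∉ Set.range f → e r = 0 := fun r hr => he r fun ⟨j, hj⟩ => hr ⟨_, hj⟩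
  have hM : (Matrix.of (Fin.cons (fun l => diagForm A B d i (t l))
        (fun a l => diagForm A B e (s a) (t l)) : Fin (p + 1) → Fin (p + 1) → ℝ)) =
      (Matrix.of (Fin.cons (fun j => A i (f j) * d (f j))
        (fun a j => A (s a) (f j) * e (f j)) : Fin (p + 1) → Fin (p + 1) → ℝ)) *
        (B.submatrix t f)ᵀ := by
    ext a l
    refine Fin.cases ?_ (fun a => ?_) a
    · have := congrFun (congrFun (diagForm_submatrix_eq_mul A B d hf hd (fun _ : Fin 1 => i) t) 0) l
      simpa [mul_apply] using this
    · have := congrFun (congrFun (diagForm_submatrix_eq_mul A B e hf he' s t) a) l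
      simpa [mul_apply] using this
  rw [borderedMinor, hM, det_mul, det_transpose, det_succ_column_zero, Fin.sum_univ_succ,
    Finset.sum_eq_zero, add_zero]
  · have : ((Matrix.of (Fin.cons (fun j => A i (f j) * d (f j))
        (fun a j => A (s a) (f j) * e (f j)) : Fin (p + 1) → Fin (p + 1) → ℝ)).submatrix
        (Fin.succAbove 0) Fin.succ) =
        Matrix.of fun a j => e (f (Fin.succ j)) * (A.submatrix s (f ∘ Fin.succ)) a j := by
      ext a j
      simp [mul_comm]
    rw [this, det_mul_row]
    simp
    ring
  · intro a _
    simp [h0]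
end

/-! ### Vectors in general position -/

theorem exists_ne_zero_vecMul_eq_zero {h : ℕ} {ι : Type*} [Fintype ι]
    (M : Matrix (Fin (h + 1)) ι ℝ) (hι : Fintype.card ι ≤ h) : ∃ y, y ≠ 0 ∧ y ᵥ* M = 0 := by
  have := M.vecMulLinear.ker_ne_bot_of_finrank_lt (by simp; omega)
  obtain ⟨y, hy, hne⟩ := (Submodule.ne_bot_iff _).1 this
  exact ⟨y, hne, by simpa using hy⟩

/-- The columns of `C` are in general position: a nonzero vector is orthogonal to at most `h` of
them, `h + 1` being the number of rows. -/
def GenPos {h R : ℕ} (C : Matrix (Fin (h + 1)) (Fin R) ℝ) : Prop :=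
  ∀ y, y ≠ 0 → #{r | (y ᵥ* C) r = 0} ≤ h

theorem exists_ne_zero_of_card_le {h R : ℕ} (C : Matrix (Fin (h + 1)) (Fin R) ℝ)
    {S : Finset (Fin R)} (hS : #S ≤ h) : ∃ y, y ≠ 0 ∧ ∀ r ∈ S, (y ᵥ* C) r = 0 := by
  obtain ⟨y, hy, h0⟩ := exists_ne_zero_vecMul_eq_zero (C.submatrix id (Subtype.val : S → Fin R))
    (by simpa using hS)
  exact ⟨y, hy, fun r hr => congrFun h0 ⟨r, hr⟩⟩

theorem GenPos.eq_zero {h R : ℕ} {C : Matrix (Fin (h + 1)) (Fin R) ℝ} (hC : GenPos C)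
    {S : Finset (Fin R)} (hS : h < #S) {y : Fin (h + 1) → ℝ} (hy : ∀ r ∈ S, (y ᵥ* C) r = 0) :
    y = 0 := by
  by_contra hne
  have : #S ≤ #{r | (y ᵥ* C) r = 0} := card_le_card fun r hr => by simpa using hy r hr
  have := hC y hne
  omega

/-- A vector whose orthogonal columns are exactly those in `S`. -/
theorem GenPos.exists_vecMul_eq_zero_iff {h R : ℕ} {C : Matrix (Fin (h + 1)) (Fin R) ℝ}
    (hC : GenPos C) {S : Finset (Fin R)} (hS : #S = h) :
    ∃ y, ∀ r, (y ᵥ* C) r = 0 ↔ r ∈ S := by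
  obtain ⟨y, hne, hy⟩ := exists_ne_zero_of_card_le C hS.le
  refine ⟨y, fun r => ⟨fun hr => ?_, hy r⟩⟩
  by_contra hrS
  refine hne (hC.eq_zero (S := insert r S) (by rw [card_insert_of_notMem hrS]; omega) ?_)
  simpa [hr] using hy

/-- Subtracting the multiple of x that agrees with y on one further column q leaves a vector
orthogonal to h + 1 columns, hence zero. -/
theorem GenPos.eq_smul {h R : ℕ} {C : Matrix (Fin (h + 1)) (Fin R) ℝ} (hC : GenPos C) (hR : h < R)
    {S : Finset (Fin R)} (hS : #S = h) {x y : Fin (h + 1) → ℝ}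
    (hx : ∀ r, (x ᵥ* C) r = 0 ↔ r ∈ S) (hy : ∀ r ∈ S, (y ᵥ* C) r = 0) : ∃ t : ℝ, y = t • x := by
  obtain ⟨q, hq⟩ : ∃ q, q ∉ S := by
    by_contra! hall
    have := card_le_card (fun q _ => hall q : univ ⊆ S)
    simp at this
    omega
  have hxq : (x ᵥ* C) q ≠ 0 := fun h0 => hq ((hx q).1 h0)
  refine ⟨(y ᵥ* C) q / (x ᵥ* C) q, sub_eq_zero.1 (hC.eq_zero (S := insert q S) ?_ ?_)⟩
  · rw [card_insert_of_notMem hq]; omega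
  · intro r hr
    rw [sub_vecMul, smul_vecMul, Pi.sub_apply, Pi.smul_apply, smul_eq_mul]
    rcases mem_insert.1 hr with rfl | hr
    · field_simp; ring
    · rw [hy r hr, (hx r).2 hr]; ring

/-! ### Kruskal's permutation lemma, by counting columns in spans -/

section Permutation

variable {h R : ℕ} (C C' : Matrix (Fin (h + 1)) (Fin R) ℝ)

open Classical in
/-- The columns of `C` that are orthogonal to every vector orthogonal to the columns in `S` of
`C'`. -/
def spannedColumns (S : Finset (Fin R)) : Finset (Fin R) :=
  {i | ∀ y : Fin (h + 1) → ℝ, (∀ r ∈ S, (y ᵥ* C') r = 0) → (y ᵥ* C) i = 0}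

variable {C C'}

theorem mem_spannedColumns {S : Finset (Fin R)} {i : Fin R} :
    i ∈ spannedColumns C C' S ↔
      ∀ y : Fin (h + 1) → ℝ, (∀ r ∈ S, (y ᵥ* C') r = 0) → (y ᵥ* C) i = 0 := by
  classical
  simp [spannedColumns]

theorem spannedColumns_mono {S S' : Finset (Fin R)} (hS : S ⊆ S') :
    spannedColumns C C' S ⊆ spannedColumns C C' S' := fun _ hi =>
  mem_spannedColumns.2 fun y hy => mem_spannedColumns.1 hi y fun r hr => hy r (hS hr)

/-- Were #S + 1 columns of C spanned by S, one could enlarge them to h + 1 columns. Orthogonality to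
all of these would follow from only #S + (h - #S) = h equations, which have a nonzero solution in
dimension h + 1. -/
theorem card_spannedColumns_le (hC : GenPos C) (hR : h < R) {S : Finset (Fin R)} (hS : #S ≤ h) :
    #(spannedColumns C C' S) ≤ #S := by
  by_contra! hlt
  obtain ⟨Z, hZ, hZc⟩ := exists_subset_card_eq (Nat.succ_le_of_lt hlt)
  obtain ⟨W, hZW, hWc⟩ := exists_superset_card_eq (s := Z) (n := h + 1)
    (by omega) (by simpa using hR)
  have hd : #(W \ Z) = h - #S := by rw [card_sdiff_of_subset hZW]; omega
  obtain ⟨y, hy, h0⟩ := exists_ne_zero_vecMul_eq_zero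
    (Matrix.of fun l => Sum.elim (fun r : S => C' l r) (fun r : (W \ Z : Finset _) => C l r))
    (by rw [Fintype.card_sum, Fintype.card_coe, Fintype.card_coe]; omega)
  have h1 : ∀ r ∈ S, (y ᵥ* C') r = 0 := fun r hr => congrFun h0 (Sum.inl ⟨r, hr⟩)
  refine hy (hC.eq_zero (S := W) (by omega) fun r hr => ?_)
  by_cases hrZ : r ∈ Z
  · exact mem_spannedColumns.1 (hZ hrZ) y h1
  · exact congrFun h0 (Sum.inr ⟨r, mem_sdiff.2 ⟨hr, hrZ⟩⟩)

theorem exists_orthogonal_except (hC' : GenPos C') (hR : h < R) {S : Finset (Fin R)}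
    (hS : #S ≤ h) {q : Fin R} (hq : q ∉ S) :
    ∃ y : Fin (h + 1) → ℝ, (∀ r ∈ S, (y ᵥ* C') r = 0) ∧ (y ᵥ* C') q ≠ 0 := by
  obtain ⟨W, hSW, hW, hWc⟩ := exists_subsuperset_card_eq (s := S) (t := univ.erase q) (n := h)
    (subset_erase.2 ⟨subset_univ _, hq⟩) hS (by simp; omega)
  obtain ⟨y, hy⟩ := hC'.exists_vecMul_eq_zero_iff hWc
  exact ⟨y, fun r hr => (hy r).2 (hSW hr), fun h0 => by simpa using hW ((hy q).1 h0)⟩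

/-- A vector z orthogonal to S and q but not to q' serves to correct any y orthogonal to S into one
orthogonal to q' as well; the correction does not change the pairing with column i. -/
theorem inter_spannedColumns_subset (hC' : GenPos C') (hR : h < R) {S : Finset (Fin R)}
    (hS : #S + 1 ≤ h) {q q' : Fin R} (hq : q ∉ S) (hq' : q' ∉ S) (hne : q ≠ q') {i : Fin R}
    (hi : i ∈ spannedColumns C C' (insert q S)) (hi' : i ∈ spannedColumns C C' (insert q' S)) :
    i ∈ spannedColumns C C' S := by
  refine mem_spannedColumns.2 fun y hy => ?_
  obtain ⟨z, hz, hzq⟩ := exists_orthogonal_except hC' hR (S := insert q S) (q := q')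
    (by rw [card_insert_of_notMem hq]; exact hS) (by simp [hne.symm, hq'])
  have h1 := mem_spannedColumns.1 hi z hz
  have h2 := mem_spannedColumns.1 hi' (y - ((y ᵥ* C') q' / (z ᵥ* C') q') • z) (by
    intro r hr
    rw [sub_vecMul, smul_vecMul, Pi.sub_apply, Pi.smul_apply, smul_eq_mul]
    rcases mem_insert.1 hr with rfl | hr
    · field_simp; ring
    · rw [hy r hr, hz r (mem_insert_of_mem hr)]; ring)
  rw [sub_vecMul, smul_vecMul, Pi.sub_apply, Pi.smul_apply, h1] at h2
  simpa using h2

/-- Downward induction on #S from h to 0. Going down, the new columns spanned after adding each q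
outside S form disjoint sets of known size, and these must fit into the columns not spanned by S. -/
theorem card_spannedColumns (hC : GenPos C) (hC' : GenPos C') (hR : h < R)
    (hz : ∀ y, y ≠ 0 → h ≤ #{r | (y ᵥ* C') r = 0} → #{r | (y ᵥ* C) r = 0} = h) (j : ℕ) :
    j ≤ h → ∀ S : Finset (Fin R), #S = h - j → #(spannedColumns C C' S) = h - j := by
  induction j with
  | zero =>
    intro _ S hS
    obtain ⟨y, hy⟩ := hC'.exists_vecMul_eq_zero_iff hS
    have hy0 : y ≠ 0 := by
      rintro rfl
      have := card_le_card (fun q _ => (hy q).1 (by simp) : univ ⊆ S)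
      simp at this
      omega
    -- The vectors orthogonal to h columns of C' form the line through y, so the spanned columns are
    -- those orthogonal to y, which the hypothesis counts.
    refine Eq.trans (congrArg card ?_) (hz y hy0 (by simp [hy, hS]))
    ext i
    rw [mem_spannedColumns, mem_filter_univ]
    refine ⟨fun hi => hi y fun r hr => (hy r).2 hr, fun hi z hzS => ?_⟩
    obtain ⟨t, rfl⟩ := hC'.eq_smul hR hS hy hzS
    simp [smul_vecMul, hi]
  | succ j ih =>
    intro hj S hS
    have hle := card_spannedColumns_le (C' := C') hC hR (S := S) (by omega)
    have hins : ∀ q ∈ Sᶜ, #(spannedColumns C C' (insert q S) \ spannedColumns C C' S) =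
        #S + 1 - #(spannedColumns C C' S) := by
      intro q hq
      rw [card_sdiff_of_subset (spannedColumns_mono (subset_insert q S)),
        ih (by omega) (insert q S) (by rw [card_insert_of_notMem (by simpa using hq)]; omega)]
      congr 1
      omega
    have hdisj : (Sᶜ : Set (Fin R)).PairwiseDisjoint fun q =>
        spannedColumns C C' (insert q S) \ spannedColumns C C' S := by
      intro q hq q' hq' hne
      refine disjoint_left.2 fun i hi hi' => (mem_sdiff.1 hi).2 ?_
      exact inter_spannedColumns_subset hC' hR (by omega) (by simpa using hq) (by simpa using hq')
        hne (mem_sdiff.1 hi).1 (mem_sdiff.1 hi').1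
    have hU := card_le_card (s := Sᶜ.biUnion fun q =>
      spannedColumns C C' (insert q S) \ spannedColumns C C' S) (t := (spannedColumns C C' S)ᶜ)
      (by
        intro i hi
        obtain ⟨q, -, hq⟩ := mem_biUnion.1 hi
        exact mem_compl.2 (mem_sdiff.1 hq).2)
    rw [card_biUnion (by simpa using hdisj), sum_congr rfl hins, sum_const, card_compl, card_compl,
      Fintype.card_fin, smul_eq_mul] at hU
    obtain ⟨e, he⟩ := Nat.exists_eq_add_of_le hle
    obtain ⟨m, hm⟩ : ∃ m, R = #S + 2 + m := Nat.exists_eq_add_of_le (by omega)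
    have h1 : R - #S = m + 2 := by omega
    have h2 : #S + 1 - #(spannedColumns C C' S) = e + 1 := by omega
    have h3 : R - #(spannedColumns C C' S) = m + 2 + e := by omega
    rw [h1, h2, h3] at hU
    -- The inequality now reads (m + 2)(e + 1) ≤ m + 2 + e, that is (m + 1) e ≤ 0.
    have : e = 0 := by nlinarith
    omega

/-- A version of Kruskal's permutation lemma. -/
theorem exists_perm_vecMul_eq (hh : 1 ≤ h) (hC : GenPos C) (hC' : GenPos C') (hR : h < R)
    (hz : ∀ y, y ≠ 0 → h ≤ #{r | (y ᵥ* C') r = 0} → #{r | (y ᵥ* C) r = 0} = h) :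
    ∃ π : Equiv.Perm (Fin R), ∀ r, ∃ c : ℝ, c ≠ 0 ∧
      ∀ y : Fin (h + 1) → ℝ, (y ᵥ* C) (π r) = c * (y ᵥ* C') r := by
  -- The count at #S = 1 assigns to each column of C' its partner in C; the count at #S = 0 says
  -- that C has no zero column.
  have hone : ∀ r, ∃ i, spannedColumns C C' {r} = {i} := fun r => card_eq_one.1 <| by
    rw [card_spannedColumns hC hC' hR hz (h - 1) (by omega) {r} (by rw [card_singleton]; omega)]
    omega
  have hempty : spannedColumns C C' ∅ = ∅ := card_eq_zero.1 <| by
    rw [card_spannedColumns hC hC' hR hz h le_rfl ∅ (by simp)]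
    omega
  choose π hπ using hone
  have hmem : ∀ r, π r ∈ spannedColumns C C' {r} := fun r => by simp [hπ r]
  have hinj : Function.Injective π := by
    intro r q hrq
    by_contra hne
    have := inter_spannedColumns_subset hC' hR (S := ∅) (by simpa using hh) (by simp) (by simp)
      hne (by simpa using hmem r) (by simpa [hrq] using hmem q)
    simp [hempty] at this
  refine ⟨Equiv.ofBijective π (Finite.injective_iff_bijective.1 hinj), fun r => ?_⟩
  obtain ⟨z, -, hzr⟩ := exists_orthogonal_except hC' hR (S := ∅) (q := r) (by simp) (by simp)
  have key : ∀ y : Fin (h + 1) → ℝ,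
      (y ᵥ* C) (π r) = (z ᵥ* C) (π r) / (z ᵥ* C') r * (y ᵥ* C') r := by
    intro y
    have := mem_spannedColumns.1 (hmem r) (y - ((y ᵥ* C') r / (z ᵥ* C') r) • z) (by
      intro q hq
      rw [mem_singleton.1 hq, sub_vecMul, smul_vecMul, Pi.sub_apply, Pi.smul_apply, smul_eq_mul]
      field_simp; ring)
    rw [sub_vecMul, smul_vecMul, Pi.sub_apply, Pi.smul_apply, smul_eq_mul, sub_eq_zero] at this
    rw [this]
    ring
  refine ⟨_, fun h0 => ?_, key⟩
  have : π r ∈ spannedColumns C C' ∅ := mem_spannedColumns.2 fun y _ => by rw [key, h0, zero_mul]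
  simp [hempty] at this

end Permutation

/-! ### Uniqueness of the first two factors -/

section Uniqueness

variable {I J R h p : ℕ} {A A' : Matrix (Fin I) (Fin R) ℝ} {B B' : Matrix (Fin J) (Fin R) ℝ}
  {C C' : Matrix (Fin (h + 1)) (Fin R) ℝ}

theorem diagForm_comm (A : Matrix (Fin I) (Fin R) ℝ) (B : Matrix (Fin J) (Fin R) ℝ)
    (d : Fin R → ℝ) : diagForm B A d = (diagForm A B d)ᵀ := by
  ext i j
  simp [diagForm, mul_comm]

theorem card_support_add (d : Fin R → ℝ) : #{r | d r ≠ 0} + #{r | d r = 0} = R := by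
  have := card_filter_add_card_filter_not (s := (univ : Finset (Fin R))) (fun r => d r ≠ 0)
  simpa using this

/-- At least h zeros of yᵀC' leave at most p terms, so the (p + 1)-minors vanish and yᵀC has at
least h zeros, exactly h by general position. Its p remaining terms give a nonzero p-minor, so yᵀC'
cannot have fewer than p nonzero entries. -/
theorem card_zeros_eq (hpR : p + h = R) (hh : 1 ≤ h)
    (hAB : FullColumnRank (khatriRao (compound (p + 1) A) (compound (p + 1) B)))
    (hC : GenPos C) (hT : ∀ y, diagForm A B (y ᵥ* C) = diagForm A' B' (y ᵥ* C'))
    {y : Fin (h + 1) → ℝ} (hy : y ≠ 0) (hz : h ≤ #{r | (y ᵥ* C') r = 0}) :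
    #{r | (y ᵥ* C) r = 0} = h ∧ #{r | (y ᵥ* C') r = 0} = h := by
  have hn : p + 1 ≤ R := by omega
  have e := card_support_add (y ᵥ* C)
  have e' := card_support_add (y ᵥ* C')
  have h1 : #{r | (y ᵥ* C) r ≠ 0} < p + 1 := hAB.card_lt_of_minors fun s t => by
    rw [hT]
    exact det_diagForm_submatrix_eq_zero A' B' (by omega) s t
  have h2 := hC y hy
  have h3 := card_support_le_of_diagForm_eq (hAB.allMinors_left.mono hn h1.le)
    (hAB.allMinors_right.mono hn h1.le) (hT y)
  omega

/-- Zero patterns with which `borderedMinor` isolates the term `f 0`. -/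
structure Isolates (C : Matrix (Fin (h + 1)) (Fin R) ℝ) (f : Fin (p + 1) → Fin R)
    (x y : Fin (h + 1) → ℝ) : Prop where
  fst_eq_zero : ∀ r, r ∉ Set.range f → (x ᵥ* C) r = 0
  fst_ne_zero : (x ᵥ* C) (f 0) ≠ 0
  snd_eq_zero : ∀ r, r ∉ Set.range (f ∘ Fin.succ) → (y ᵥ* C) r = 0
  snd_ne_zero : ∀ j, (y ᵥ* C) (f (Fin.succ j)) ≠ 0

theorem Isolates.exists_borderedMinor_eq {f : Fin (p + 1) → Fin R} {x y : Fin (h + 1) → ℝ}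
    (hx : Isolates C f x y) (hf : Function.Injective f) (hn : p + 1 ≤ R)
    (hA : AllMinors (p + 1) A) (hB : AllMinors (p + 1) B) :
    ∃ (s : Fin p → Fin I) (t : Fin (p + 1) → Fin J), ∃ c : ℝ, c ≠ 0 ∧ ∀ i,
      borderedMinor (diagForm A B (x ᵥ* C)) (diagForm A B (y ᵥ* C)) s t i = A i (f 0) * c := by
  obtain ⟨s, hs⟩ := hA.of_succ hn (f ∘ Fin.succ) (hf.comp (Fin.succ_injective _))
  obtain ⟨t, ht⟩ := hB f hf
  exact ⟨s, t, _, mul_ne_zero (mul_ne_zero (mul_ne_zero hx.fst_ne_zero hs)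
    (prod_ne_zero_iff.2 fun j _ => hx.snd_ne_zero j)) ht,
    fun i => borderedMinor_diagForm hf hx.fst_eq_zero hx.snd_eq_zero s t i⟩

theorem AllMinors.exists_ne_zero (hA : AllMinors (p + 1) A) (hn : p + 1 ≤ R) (r : Fin R) :
    ∃ i, A i r ≠ 0 := by
  obtain ⟨s, hs⟩ := hA.mono hn (show 1 ≤ p + 1 by omega) (fun _ => r)
    (fun a b _ => Subsingleton.elim a b)
  exact ⟨s 0, by simpa using hs⟩

theorem exists_injective_apply_zero (hn : p + 1 ≤ R) (r : Fin R) :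
    ∃ f : Fin (p + 1) → Fin R, Function.Injective f ∧ f 0 = r := by
  refine ⟨Equiv.swap r (Fin.castLE hn 0) ∘ Fin.castLE hn,
    (Equiv.injective _).comp (Fin.castLE_injective hn), ?_⟩
  simp

theorem card_compl_image {q : ℕ} {f : Fin q → Fin R} (hf : Function.Injective f) :
    #(univ.image f)ᶜ = R - q := by
  rw [card_compl, card_image_of_injective _ hf]
  simp

/-- Vectors supported on all columns in the range of `f` except one, and on all except `f 0`,
isolate the term `f 0`. -/
theorem isolates_of_support {f : Fin (p + 1) → Fin R} {l : Fin (p + 1)}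
    (hl : l ≠ 0) {x y : Fin (h + 1) → ℝ}
    (hx : ∀ r, (x ᵥ* C) r = 0 ↔ r ∉ univ.image (f ∘ l.succAbove))
    (hy : ∀ r, (y ᵥ* C) r = 0 ↔ r ∉ univ.image (f ∘ Fin.succ)) : Isolates C f x y where
  fst_eq_zero r hr := (hx r).2 fun hmem => hr (by
    obtain ⟨j, -, rfl⟩ := mem_image.1 hmem
    exact ⟨_, rfl⟩)
  fst_ne_zero h0 := (hx _).1 h0 (by
    obtain ⟨j, hj⟩ := Fin.exists_succAbove_eq hl.symm
    exact mem_image.2 ⟨j, mem_univ _, by simp [hj]⟩)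
  snd_eq_zero r hr := (hy r).2 fun hmem => hr (by
    obtain ⟨j, -, rfl⟩ := mem_image.1 hmem
    exact ⟨_, rfl⟩)
  snd_ne_zero j h0 := (hy _).1 h0 (mem_image_of_mem _ (mem_univ j))

/-- Omitting f 1, respectively f 0, from the range of f leaves p columns, and the complement has the
h elements that general position allows to be killed. -/
theorem GenPos.exists_isolates (hC : GenPos C) (hpR : p + h = R) (hp : 1 ≤ p)
    {f : Fin (p + 1) → Fin R} (hf : Function.Injective f) : ∃ x y, Isolates C f x y := by
  have hl : (⟨1, by omega⟩ : Fin (p + 1)) ≠ 0 := by simp [Fin.ext_iff]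
  obtain ⟨x, hx⟩ := hC.exists_vecMul_eq_zero_iff (S := (univ.image
    (f ∘ (⟨1, by omega⟩ : Fin (p + 1)).succAbove))ᶜ)
    (by rw [card_compl_image (hf.comp Fin.succAbove_right_injective)]; omega)
  obtain ⟨y, hy⟩ := hC.exists_vecMul_eq_zero_iff (S := (univ.image (f ∘ Fin.succ))ᶜ)
    (by rw [card_compl_image (hf.comp (Fin.succ_injective _))]; omega)
  exact ⟨x, y, isolates_of_support hl (fun r => by rw [hx, mem_compl])
    fun r => by rw [hy, mem_compl]⟩

/-- One bordered minor is computed from both decompositions: matched columns vanish at the same x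
and y, so it is a multiple of column f 0 of A' and a nonzero multiple of column π (f 0) of A. -/
theorem col_proportional (hpR : p + h = R) (hp : 1 ≤ p) (hh : 1 ≤ h) (hA : AllMinors (p + 1) A)
    (hB : AllMinors (p + 1) B) (hC' : GenPos C')
    (hT : ∀ y, diagForm A B (y ᵥ* C) = diagForm A' B' (y ᵥ* C')) (π : Equiv.Perm (Fin R))
    (hπ : ∀ r, ∃ c : ℝ, c ≠ 0 ∧ ∀ y : Fin (h + 1) → ℝ, (y ᵥ* C) (π r) = c * (y ᵥ* C') r)
    (r : Fin R) : ∃ a : ℝ, a ≠ 0 ∧ ∀ i, A' i r = a * A i (π r) := by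
  have hn : p + 1 ≤ R := by omega
  obtain ⟨f, hf, rfl⟩ := exists_injective_apply_zero hn r
  obtain ⟨x, y, hxy⟩ := hC'.exists_isolates hpR hp hf
  choose c hc hcy using hπ
  have hxy' : Isolates C (π ∘ f) x y := by
    refine ⟨fun r hr => ?_, ?_, fun r hr => ?_, fun j => ?_⟩
    · obtain ⟨q, rfl⟩ := π.surjective r
      rw [hcy, hxy.fst_eq_zero, mul_zero]
      rintro ⟨j, rfl⟩
      exact hr ⟨j, rfl⟩
    · exact (hcy _ _).trans_ne (mul_ne_zero (hc _) hxy.fst_ne_zero)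
    · obtain ⟨q, rfl⟩ := π.surjective r
      rw [hcy, hxy.snd_eq_zero, mul_zero]
      rintro ⟨j, rfl⟩
      exact hr ⟨j, rfl⟩
    · exact (hcy _ _).trans_ne (mul_ne_zero (hc _) (hxy.snd_ne_zero j))
  obtain ⟨s, t, e, he, hst⟩ := hxy'.exists_borderedMinor_eq (π.injective.comp hf) hn hA hB
  have hst' := fun i => borderedMinor_diagForm (A := A') (B := B') hf hxy.fst_eq_zero
    hxy.snd_eq_zero s t i
  simp only [hT, hst'] at hst
  generalize (x ᵥ* C') (f 0) * _ * _ * _ = e' at hst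
  -- No minor of A' or B' is known to be nonzero; the factor is nonzero because column π (f 0) of A
  -- is.
  have he' : e' ≠ 0 := by
    rintro rfl
    obtain ⟨i, hi⟩ := hA.exists_ne_zero hn (π (f 0))
    have := hst i
    rw [mul_zero] at this
    exact mul_ne_zero hi he this.symm
  refine ⟨e / e', div_ne_zero he he', fun i => ?_⟩
  have := hst i
  simp only [Function.comp_apply] at this
  field_simp
  linarith

theorem exists_perm_factors (hpR : p + h = R) (hp : 1 ≤ p) (hh : 1 ≤ h)
    (hAB : FullColumnRank (khatriRao (compound (p + 1) A) (compound (p + 1) B)))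
    (hC : GenPos C) (hT : ∀ y, diagForm A B (y ᵥ* C) = diagForm A' B' (y ᵥ* C')) :
    ∃ π : Equiv.Perm (Fin R), (∀ r, ∃ a : ℝ, a ≠ 0 ∧ ∀ i, A' i r = a * A i (π r)) ∧
      ∀ r, ∃ b : ℝ, b ≠ 0 ∧ ∀ j, B' j r = b * B j (π r) := by
  have hz := fun y => card_zeros_eq (y := y) hpR hh hAB hC hT
  -- General position passes from C to C': a nonzero y with more than h zeros in yᵀC' would have
  -- exactly h.
  have hC' : GenPos C' := by
    intro y hy
    by_contra! hlt
    have := (hz y hy hlt.le).2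
    omega
  obtain ⟨π, hπ⟩ := exists_perm_vecMul_eq hh hC hC' (by omega) fun y hy h0 => (hz y hy h0).1
  refine ⟨π, col_proportional hpR hp hh hAB.allMinors_left hAB.allMinors_right hC' hT π hπ,
    col_proportional hpR hp hh hAB.allMinors_right hAB.allMinors_left (A' := B') (B' := A') hC'
      (fun y => ?_) π hπ⟩
  rw [diagForm_comm, hT, ← diagForm_comm]

end Uniqueness

/-! ### Symmetric tensors and the kernel of the minors -/

section Moments

variable {k n : ℕ}

/-- The multiset of the values of `f`. -/
def symOf (f : Fin n → Fin k) : Sym (Fin k) n := ⟨univ.val.map f, by simp⟩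

theorem symOf_comp_perm (f : Fin n → Fin k) (σ : Equiv.Perm (Fin n)) :
    symOf (f ∘ σ) = symOf f := by
  apply Subtype.ext
  simp only [symOf]
  rw [← Multiset.map_map, Multiset.map_univ_val_equiv]

theorem symOf_cons (l : Fin k) (f : Fin n → Fin k) :
    symOf (Fin.cons l f : Fin (n + 1) → Fin k) = l ::ₛ symOf f := by
  apply Subtype.ext
  simp only [symOf, Sym.cons]
  rw [Fin.univ_val_map, Fin.univ_val_map, List.ofFn_cons]
  rfl

/-- The monomial `α` at the point `x`. -/
def moment (x : Fin k → ℝ) (α : Sym (Fin k) n) : ℝ := ((α : Multiset (Fin k)).map x).prod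

theorem moment_symOf (x : Fin k → ℝ) (f : Fin n → Fin k) : moment x (symOf f) = ∏ i, x (f i) := by
  change ((univ.val.map f).map x).prod = _
  rw [Multiset.map_map]
  rfl

theorem moment_cons (x : Fin k → ℝ) (l : Fin k) (β : Sym (Fin k) n) :
    moment x (l ::ₛ β) = x l * moment x β := by
  simp [moment, Sym.coe_cons]

theorem moment_replicate (x : Fin k → ℝ) (l : Fin k) :
    moment x (Sym.replicate n l) = x l ^ n := by
  simp [moment, Sym.coe_replicate]

variable {R : ℕ} (C : Matrix (Fin k) (Fin R) ℝ)

/-- The symmetric tensor `v` evaluated at the columns `g 0, g 1, …` of `C`. -/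
def contract (g : Fin n → Fin R) (v : Sym (Fin k) n → ℝ) : ℝ :=
  ∑ f : Fin n → Fin k, (∏ i, C (f i) (g i)) * v (symOf f)

theorem contract_moment (g : Fin n → Fin R) (x : Fin k → ℝ) :
    contract C g (moment x) = ∏ i, (x ᵥ* C) (g i) := by
  simp only [contract, moment_symOf, vecMul, dotProduct]
  rw [Finset.prod_univ_sum]
  simp only [Fintype.piFinset_univ]
  refine Finset.sum_congr rfl fun f _ => ?_
  rw [← Finset.prod_mul_distrib]
  exact Finset.prod_congr rfl fun i _ => mul_comm _ _

theorem contract_comp_perm (g : Fin n → Fin R) (σ : Equiv.Perm (Fin n))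
    (v : Sym (Fin k) n → ℝ) : contract C (g ∘ σ) v = contract C g v := by
  unfold contract
  refine Fintype.sum_equiv (Equiv.arrowCongr σ (Equiv.refl _)) _ _ fun f => ?_
  have h1 : (Equiv.arrowCongr σ (Equiv.refl (Fin k))) f = f ∘ σ.symm := rfl
  rw [h1, symOf_comp_perm]
  congr 1
  refine Fintype.prod_equiv σ _ _ fun i => ?_
  simp

theorem contract_cons (j : Fin R) (g : Fin n → Fin R) (v : Sym (Fin k) (n + 1) → ℝ) :
    contract C (Fin.cons j g : Fin (n + 1) → Fin R) v =
      ∑ l, C l j * contract C g fun β => v (l ::ₛ β) := by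
  unfold contract
  rw [← (Fin.consEquiv fun _ => Fin k).sum_comp, Fintype.sum_prod_type]
  refine Finset.sum_congr rfl fun l _ => ?_
  rw [Finset.mul_sum]
  refine Finset.sum_congr rfl fun f _ => ?_
  simp [Fin.consEquiv, Fin.prod_univ_succ, symOf_cons, mul_assoc]

theorem contract_sum_smul {ι : Type*} [Fintype ι] (g : Fin n → Fin R) (a : ι → ℝ)
    (v : ι → Sym (Fin k) n → ℝ) :
    contract C g (∑ i, a i • v i) = ∑ i, a i * contract C g (v i) := by
  simp only [contract, Finset.sum_apply, Pi.smul_apply, smul_eq_mul, Finset.mul_sum]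
  rw [Finset.sum_comm]
  exact Finset.sum_congr rfl fun i _ => Finset.sum_congr rfl fun f _ => by ring

/-- The coefficients, as a polynomial in `x`, of the minor `(s, t)` of the matrix
`∑ l, x l • T l`. -/
def minorCoeff {S : Type*} [CommRing S] {I J : ℕ} (T : Fin k → Fin I → Fin J → S)
    (s : Fin n → Fin I) (t : Fin n → Fin J) (α : Sym (Fin k) n) : S :=
  ∑ f : Fin n → Fin k,
    if symOf f = α then (Matrix.of fun i j => T (f i) (s i) (t j)).det else 0

theorem map_minorCoeff {S S' : Type*} [CommRing S] [CommRing S'] (φ : S →+* S') {I J : ℕ}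
    (T : Fin k → Fin I → Fin J → S) (s : Fin n → Fin I) (t : Fin n → Fin J) (α : Sym (Fin k) n) :
    φ (minorCoeff T s t α) = minorCoeff (fun l i j => φ (T l i j)) s t α := by
  simp only [minorCoeff, map_sum]
  refine Finset.sum_congr rfl fun f _ => ?_
  split_ifs
  · rw [RingHom.map_det]; rfl
  · simp

/-- Cauchy–Binet in polarized form: each row takes its slice separately, and the symmetry of v
absorbs the row permutations in the determinant of A, leaving v evaluated at the columns Θ. -/
theorem sum_minorCoeff_mul {I J : ℕ} (A : Matrix (Fin I) (Fin R) ℝ) (B : Matrix (Fin J) (Fin R) ℝ)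
    (s : Fin n → Fin I) (t : Fin n → Fin J) (v : Sym (Fin k) n → ℝ) :
    ∑ α, minorCoeff (fun l => diagForm A B (C l)) s t α * v α =
      ∑ Θ : Fin n ↪o Fin R, (A.submatrix s Θ).det * (B.submatrix t Θ).det * contract C Θ v := by
  have h1 : ∑ α, minorCoeff (fun l => diagForm A B (C l)) s t α * v α =
      ∑ f : Fin n → Fin k,
        (Matrix.of fun i j => diagForm A B (C (f i)) (s i) (t j)).det * v (symOf f) := by
    simp only [minorCoeff, Finset.sum_mul]
    rw [Finset.sum_comm]
    refine Finset.sum_congr rfl fun f _ => ?_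
    simp only [ite_mul, zero_mul]
    rw [Finset.sum_ite_eq]
    simp
  have h2 : ∀ f : Fin n → Fin k,
      (Matrix.of fun i j => diagForm A B (C (f i)) (s i) (t j)).det =
        ∑ Θ : Fin n ↪o Fin R, (∑ σ : Equiv.Perm (Fin n), (σ.sign : ℝ) *
          ∏ j, (A (s (σ j)) (Θ j) * C (f (σ j)) (Θ j))) * (B.submatrix t Θ).det := by
    intro f
    have : (Matrix.of fun i j => diagForm A B (C (f i)) (s i) (t j)) =
        (Matrix.of fun i r => A (s i) r * C (f i) r) * (B.submatrix t id)ᵀ := by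
      ext i j
      simp only [diagForm, submatrix_apply, of_apply, mul_apply, transpose_apply, id_eq]
      exact Finset.sum_congr rfl fun r _ => by ring
    rw [this, det_mul_eq_sum_orderEmbedding]
    refine Finset.sum_congr rfl fun Θ _ => ?_
    congr 1
    · rw [det_apply']
      rfl
    · rw [← det_transpose]
      rfl
  rw [h1]
  simp only [h2, Finset.sum_mul]
  rw [Finset.sum_comm]
  refine Finset.sum_congr rfl fun Θ _ => ?_
  rw [Finset.sum_comm, det_apply' (A.submatrix s Θ), Finset.sum_mul, Finset.sum_mul]
  refine Finset.sum_congr rfl fun σ _ => ?_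
  rw [contract, Finset.mul_sum]
  -- Replacing f by f ∘ σ keeps the multiset of values and removes σ from the entries of C.
  refine Fintype.sum_equiv (Equiv.arrowCongr σ.symm (Equiv.refl _)) _ _ fun f => ?_
  have h3 : (Equiv.arrowCongr σ.symm (Equiv.refl (Fin k))) f = f ∘ σ := rfl
  rw [h3, symOf_comp_perm, Finset.prod_mul_distrib]
  simp only [submatrix_apply, Function.comp_apply]
  ring

end Moments

/-! ### The kernel of the minors is spanned by powers of the points -/

section Kernel

variable {R h p : ℕ} {C : Matrix (Fin (h + 1)) (Fin R) ℝ}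
  {x : {S : Finset (Fin R) // #S = p} → Fin (h + 1) → ℝ}

/-- Evaluation at the columns in Ω is, up to scale, dual to the p-th powers of the points: a nonzero
product forces Ω ⊆ Ω', and both have p elements. -/
theorem prod_vecMul_ne_zero_iff (hx : ∀ Ω r, (x Ω ᵥ* C) r = 0 ↔ r ∉ Ω.1)
    (Ω Ω' : {S : Finset (Fin R) // #S = p}) :
    ∏ i, (x Ω' ᵥ* C) (Ω.1.orderEmbOfFin Ω.2 i) ≠ 0 ↔ Ω' = Ω := by
  rw [Finset.prod_ne_zero_iff]
  refine ⟨fun hne => ?_, ?_⟩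
  · apply Subtype.ext
    symm
    refine eq_of_subset_of_card_le (fun r hr => ?_) (by rw [Ω.2, Ω'.2])
    obtain ⟨i, rfl⟩ : r ∈ Set.range (Ω.1.orderEmbOfFin Ω.2) := by simpa using hr
    simpa [hx] using hne i (mem_univ i)
  · rintro rfl i -
    simp [hx]

theorem linearIndependent_moment (hx : ∀ Ω r, (x Ω ᵥ* C) r = 0 ↔ r ∉ Ω.1) :
    LinearIndependent ℝ fun Ω => (moment (x Ω) : Sym (Fin (h + 1)) p → ℝ) := by
  refine Fintype.linearIndependent_iff.2 fun a ha Ω => ?_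
  have h1 := contract_sum_smul C (Ω.1.orderEmbOfFin Ω.2) a
    fun Ω => (moment (x Ω) : Sym (Fin (h + 1)) p → ℝ)
  rw [ha, Finset.sum_eq_single Ω] at h1
  · rw [contract_moment] at h1
    have h0 : contract C (Ω.1.orderEmbOfFin Ω.2) (0 : Sym (Fin (h + 1)) p → ℝ) = 0 := by
      simp [contract]
    rw [h0] at h1
    exact (mul_eq_zero.1 h1.symm).resolve_right ((prod_vecMul_ne_zero_iff hx Ω Ω).2 rfl)
  · intro Ω' _ hne
    rw [contract_moment]
    by_contra hne'
    exact hne ((prod_vecMul_ne_zero_iff hx Ω Ω').1 (right_ne_zero_of_mul hne'))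
  · simp

/-- Both numbers are the binomial coefficient of p + h over p. Hence the independent p-th powers
form a basis, and the later pencils are square. -/
theorem card_sym_eq_card_subtype (hpR : p + h = R) :
    Fintype.card (Sym (Fin (h + 1)) p) = Fintype.card {S : Finset (Fin R) // #S = p} := by
  rw [Sym.card_sym_eq_choose, Fintype.card_finset_len, Fintype.card_fin, Fintype.card_fin]
  congr 1
  omega

theorem span_moment_eq_top (hpR : p + h = R) (hx : ∀ Ω r, (x Ω ᵥ* C) r = 0 ↔ r ∉ Ω.1) :
    Submodule.span ℝ (Set.range fun Ω => (moment (x Ω) : Sym (Fin (h + 1)) p → ℝ)) = ⊤ := by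
  apply (linearIndependent_moment hx).span_eq_top_of_card_eq_finrank'
  rw [Module.finrank_fintype_fun_eq_card, card_sym_eq_card_subtype hpR]

theorem ne_zero_of_vecMul_iff (hp : 1 ≤ p) (hx : ∀ Ω r, (x Ω ᵥ* C) r = 0 ↔ r ∉ Ω.1)
    (Ω : {S : Finset (Fin R) // #S = p}) : ∃ l, x Ω l ≠ 0 := by
  by_contra! h0
  obtain ⟨r, hr⟩ := card_pos.1 (show 0 < #Ω.1 by rw [Ω.2]; omega)
  refine (hx Ω r).not.2 (not_not.2 hr) ?_
  simp [vecMul, dotProduct, h0]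

/-- Stripping one factor l reduces a relation to degree p with coefficients multiplied by x Ω l; for
each Ω some l makes this nonzero. -/
theorem linearIndependent_moment_succ (hp : 1 ≤ p)
    (hx : ∀ Ω r, (x Ω ᵥ* C) r = 0 ↔ r ∉ Ω.1) :
    LinearIndependent ℝ fun Ω => (moment (x Ω) : Sym (Fin (h + 1)) (p + 1) → ℝ) := by
  refine Fintype.linearIndependent_iff.2 fun a ha Ω => ?_
  obtain ⟨l, hl⟩ := ne_zero_of_vecMul_iff hp hx Ω
  have := Fintype.linearIndependent_iff.1 (linearIndependent_moment hx) (fun Ω => a Ω * x Ω l) (by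
    ext β
    have := congrFun ha (l ::ₛ β)
    simpa [Finset.sum_apply, moment_cons, mul_assoc] using this) Ω
  exact (mul_eq_zero.1 this).resolve_right hl

/-- Each contraction v (l ::ₛ ·) has degree p and expands in the p-th powers with coefficients z l
Ω. Evaluating v at the columns r and Ω, for r ∉ Ω, shows that the vector z · Ω is orthogonal to
column r. Hence it is a multiple of x Ω, which turns each p-th power into a power of order p + 1. -/
theorem GenPos.exists_eq_sum_moment (hC : GenPos C) (hpR : p + h = R) (hp : 1 ≤ p)
    (hx : ∀ Ω r, (x Ω ᵥ* C) r = 0 ↔ r ∉ Ω.1) {v : Sym (Fin (h + 1)) (p + 1) → ℝ}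
    (hv : ∀ Θ : Fin (p + 1) ↪o Fin R, contract C Θ v = 0) :
    ∃ a : {S : Finset (Fin R) // #S = p} → ℝ, ∑ Ω, a Ω • moment (x Ω) = v := by
  have hz : ∀ l, ∃ z : {S : Finset (Fin R) // #S = p} → ℝ,
      ∑ Ω, z Ω • moment (x Ω) = fun β => v (l ::ₛ β) := fun l => by
    have := Submodule.mem_top (R := ℝ) (x := fun β => v (l ::ₛ β))
    rw [← span_moment_eq_top hpR hx] at this
    exact (Submodule.mem_span_range_iff_exists_fun ℝ).1 this
  choose z hz using hz
  have hzx : ∀ Ω, ∃ t : ℝ, (fun l => z l Ω) = t • x Ω := by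
    intro Ω
    refine hC.eq_smul (S := Ω.1ᶜ) (by omega) (by rw [card_compl, Ω.2, Fintype.card_fin]; omega)
      (fun r => by rw [hx, mem_compl]) fun r hr => ?_
    have hinj : Function.Injective
        (Fin.cons r (Ω.1.orderEmbOfFin Ω.2) : Fin (p + 1) → Fin R) := by
      refine Fin.cons_injective_iff.2 ⟨?_, (Ω.1.orderEmbOfFin Ω.2).injective⟩
      simpa using hr
    obtain ⟨Θ, σ, hΘ⟩ := exists_orderEmbedding_comp_perm hinj
    have h1 := hv Θ
    rw [← contract_comp_perm C Θ σ, ← hΘ, contract_cons] at h1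
    simp only [← hz, contract_sum_smul, contract_moment] at h1
    have h2 : ∀ l, ∑ Ω', z l Ω' * ∏ i, (x Ω' ᵥ* C) (Ω.1.orderEmbOfFin Ω.2 i) =
        z l Ω * ∏ i, (x Ω ᵥ* C) (Ω.1.orderEmbOfFin Ω.2 i) := by
      intro l
      refine Finset.sum_eq_single Ω (fun Ω' _ hne => ?_) (by simp)
      by_contra hne'
      exact hne ((prod_vecMul_ne_zero_iff hx Ω Ω').1 (right_ne_zero_of_mul hne'))
    simp only [h2, ← mul_assoc] at h1
    rw [← Finset.sum_mul] at h1
    have := (mul_eq_zero.1 h1).resolve_right ((prod_vecMul_ne_zero_iff hx Ω Ω).2 rfl)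
    simpa [vecMul, dotProduct, mul_comm] using this
  choose a ha using hzx
  refine ⟨a, ?_⟩
  ext α
  obtain ⟨l, β, rfl⟩ := α.exists_eq_cons_of_succ
  have h1 := congrFun (hz l) β
  simp only [Finset.sum_apply, Pi.smul_apply, smul_eq_mul] at h1 ⊢
  rw [← h1]
  refine Finset.sum_congr rfl fun Ω _ => ?_
  have := congrFun (ha Ω) l
  simp only [Pi.smul_apply, smul_eq_mul] at this
  rw [this, moment_cons, mul_assoc]

/-- The vectors orthogonal to the coefficients of all minors. -/
theorem mem_span_moment_iff {I J : ℕ} {A : Matrix (Fin I) (Fin R) ℝ} {B : Matrix (Fin J) (Fin R) ℝ}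
    (hAB : FullColumnRank (khatriRao (compound (p + 1) A) (compound (p + 1) B)))
    (hC : GenPos C) (hpR : p + h = R) (hp : 1 ≤ p)
    (hx : ∀ Ω r, (x Ω ᵥ* C) r = 0 ↔ r ∉ Ω.1) (v : Sym (Fin (h + 1)) (p + 1) → ℝ) :
    v ∈ Submodule.span ℝ (Set.range fun Ω => (moment (x Ω) : Sym (Fin (h + 1)) (p + 1) → ℝ)) ↔
      ∀ (s : Fin (p + 1) ↪o Fin I) (t : Fin (p + 1) ↪o Fin J),
        ∑ α, minorCoeff (fun l => diagForm A B (C l)) s t α * v α = 0 := by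
  rw [Submodule.mem_span_range_iff_exists_fun]
  simp only [sum_minorCoeff_mul]
  constructor
  · rintro ⟨a, rfl⟩ s t
    refine Finset.sum_eq_zero fun Θ _ => ?_
    rw [contract_sum_smul, Finset.sum_eq_zero, mul_zero]
    intro Ω _
    rw [contract_moment]
    -- Of p + 1 distinct columns one lies outside the p-element set Ω, where the point vanishes.
    obtain ⟨i, hi⟩ : ∃ i, Θ i ∉ Ω.1 := by
      by_contra! hall
      have := card_le_card_of_injOn Θ (s := univ) (fun i _ => hall i) Θ.injective.injOn
      rw [card_univ, Fintype.card_fin, Ω.2] at this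
      omega
    rw [Finset.prod_eq_zero (mem_univ i) ((hx Ω _).2 hi), mul_zero]
  · intro hv
    have h0 := hAB.eq_zero_of_sum (c := fun Θ => contract C Θ v) fun s t => hv s t
    exact hC.exists_eq_sum_moment hpR hp hx fun Θ => congrFun h0 Θ

end Kernel

/-! ### Simultaneously diagonalized pencils -/

section Pencil

variable {m : ℕ} {X E : Matrix (Fin m) (Fin m) ℝ} {u w : Fin m → ℝ}

theorem exists_isGEVD (hX : X.det ≠ 0) (hE : E.det ≠ 0) (hw : ∀ i, w i ≠ 0) :
    ∃ V F, IsGEVD (X * diagonal u * E) (X * diagonal w * E) V F := by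
  have hEu : IsUnit E.det := isUnit_iff_ne_zero.2 hE
  refine ⟨E⁻¹, Matrix.of fun i => ![u i, w i], ⟨0, 1, ?_⟩, ?_, fun i => ⟨Or.inr (hw i), ?_⟩⟩
  · simp [hX, hE, Finset.prod_ne_zero_iff, hw]
  · rw [det_nonsing_inv]
    simp [hE]
  · have h1 : E *ᵥ (E⁻¹).col i = Pi.single i 1 := by
      have : E⁻¹.col i = E⁻¹ *ᵥ Pi.single i 1 := by simp
      rw [this, mulVec_mulVec, mul_nonsing_inv _ hEu, one_mulVec]
    rw [← mulVec_mulVec, ← mulVec_mulVec, ← mulVec_mulVec, ← mulVec_mulVec, h1,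
      diagonal_mulVec_single, diagonal_mulVec_single, ← mulVec_smul, ← mulVec_smul]
    congr 1
    ext j
    simp only [Pi.smul_apply, Pi.single_apply, smul_eq_mul, of_apply]
    split_ifs <;> simp [mul_comm]

/-- For an eigenvector v and z = E v, each nonzero z j fixes the eigenvalue ratio to u j : w j; as
these ratios are distinct, z has one nonzero entry. Since E * V is nonsingular, every index i
occurs, whichever decomposition is returned. -/
theorem IsGEVD.exists_mulVec_eq_single (hX : X.det ≠ 0) (hE : E.det ≠ 0)
    (huw : ∀ i j, i ≠ j → u i * w j ≠ u j * w i) {V : Matrix (Fin m) (Fin m) ℝ}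
    {F : Matrix (Fin m) (Fin 2) ℝ} (hV : IsGEVD (X * diagonal u * E) (X * diagonal w * E) V F)
    (i : Fin m) : ∃ e, ∃ c : ℝ, c ≠ 0 ∧ E *ᵥ V.col e = Pi.single i c := by
  obtain ⟨-, hVdet, hF⟩ := hV
  have hEV : (E * V).det ≠ 0 := by rw [det_mul]; exact mul_ne_zero hE hVdet
  obtain ⟨e, he⟩ : ∃ e, (E * V) i e ≠ 0 := by
    by_contra! h0
    exact hEV (det_eq_zero_of_row_eq_zero i h0)
  refine ⟨e, (E * V) i e, he, ?_⟩
  set z := E *ᵥ V.col e with hz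
  have hzi : z i = (E * V) i e := rfl
  rw [← hzi] at he ⊢
  obtain ⟨hne, heq⟩ := hF e
  rw [← mulVec_mulVec, ← mulVec_mulVec, ← mulVec_mulVec, ← mulVec_mulVec, ← hz, ← mulVec_smul X,
    ← mulVec_smul (diagonal u), ← mulVec_smul X] at heq
  have hinj := (Matrix.mulVec_injective_iff_isUnit.2
    ((Matrix.isUnit_iff_isUnit_det X).2 (isUnit_iff_ne_zero.2 hX)))
  have h1 : ∀ j, F e 1 * (u j * z j) = F e 0 * (w j * z j) := fun j => by
    have := congrFun (hinj heq) j
    simp only [Pi.smul_apply, mulVec_diagonal, smul_eq_mul] at this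
    linarith
  ext j
  rcases eq_or_ne j i with rfl | hji
  · simp
  · rw [Pi.single_eq_of_ne hji]
    by_contra hzj
    have hi : F e 1 * u i = F e 0 * w i := mul_right_cancel₀ he (by linarith [h1 i])
    have hj : F e 1 * u j = F e 0 * w j := mul_right_cancel₀ hzj (by linarith [h1 j])
    have hd : u i * w j - u j * w i ≠ 0 := sub_ne_zero.2 (huw i j hji.symm)
    rcases hne with h0 | h0
    · exact hd (by
        have : F e 0 * (u i * w j - u j * w i) = 0 := by linear_combination u j * hi - u i * hj
        exact (mul_eq_zero.1 this).resolve_left h0)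
    · exact hd (by
        have : F e 1 * (u i * w j - u j * w i) = 0 := by linear_combination w j * hi - w i * hj
        exact (mul_eq_zero.1 this).resolve_left h0)

end Pencil

/-! ### Generic parameters -/

/-- Induction by Fubini: fixing the first variable leaves a nonzero polynomial in the others for all
but finitely many values. -/
theorem MvPolynomial.ae_eval_ne_zero {N : ℕ} {q : MvPolynomial (Fin N) ℝ} (hq : q ≠ 0) :
    ∀ᵐ ρ : Fin N → ℝ, MvPolynomial.eval ρ q ≠ 0 := by
  induction N with
  | zero =>
    refine Filter.Eventually.of_forall fun ρ h0 => hq ?_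
    rw [MvPolynomial.eq_C_of_isEmpty q] at h0 ⊢
    rw [MvPolynomial.eval_C] at h0
    rw [h0, map_zero]
  | succ N ih =>
    have hmp := volume_preserving_piFinSuccAbove (fun _ : Fin (N + 1) => ℝ) 0
    set e := MeasurableEquiv.piFinSuccAbove (fun _ : Fin (N + 1) => ℝ) 0
    have hmeas : MeasurableSet {z : ℝ × (Fin N → ℝ) | MvPolynomial.eval (e.symm z) q ≠ 0} := by
      have : Measurable fun ρ : Fin (N + 1) → ℝ => MvPolynomial.eval ρ q :=
        (MvPolynomial.continuous_eval q).measurable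
      exact measurableSet_eq_fun (this.comp e.symm.measurable) measurable_const |>.compl
    have key : ∀ᵐ z : ℝ × (Fin N → ℝ), MvPolynomial.eval (e.symm z) q ≠ 0 := by
      change ∀ᵐ z ∂((volume : Measure ℝ).prod (volume : Measure (Fin N → ℝ))), _
      rw [Measure.ae_prod_iff_ae_ae hmeas]
      have hne : MvPolynomial.finSuccEquiv ℝ N q ≠ 0 := by simpa using hq
      have hfin : {t : ℝ | (MvPolynomial.finSuccEquiv ℝ N q).eval (MvPolynomial.C t) = 0}.Finite :=
        Set.Finite.preimage (MvPolynomial.C_injective _ _).injOn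
          (Polynomial.finite_setOfPred_isRoot hne)
      filter_upwards [hfin.countable.ae_notMem volume] with t ht
      filter_upwards [ih ht] with s hs
      have : e.symm (t, s) = Fin.cons t s := by
        ext i
        simp [e, MeasurableEquiv.piFinSuccAbove, Fin.insertNthEquiv]
      rw [this, MvPolynomial.eval_eq_eval_mv_eval', Polynomial.eval_map]
      have h2 := Polynomial.eval₂_at_apply (p := MvPolynomial.finSuccEquiv ℝ N q)
        (MvPolynomial.eval s) (MvPolynomial.C t)
      rw [MvPolynomial.eval_C] at h2
      rwa [h2]
    have := hmp.quasiMeasurePreserving.ae key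
    simpa using this

/-- The polynomial functions of `N` real variables. -/
def polyFun (N : ℕ) : Subring ((Fin N → ℝ) → ℝ) :=
  (RingHom.pi fun ρ : Fin N → ℝ => (MvPolynomial.eval ρ : MvPolynomial (Fin N) ℝ →+* ℝ)).range

section PolyFun

variable {N : ℕ}

theorem ae_ne_zero_of_mem_polyFun {f : (Fin N → ℝ) → ℝ} (hf : f ∈ polyFun N)
    (hne : ∃ ρ, f ρ ≠ 0) : ∀ᵐ ρ, f ρ ≠ 0 := by
  obtain ⟨q, rfl⟩ := hf
  refine MvPolynomial.ae_eval_ne_zero ?_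
  rintro rfl
  simp at hne

theorem const_mem_polyFun (a : ℝ) : (fun _ => a) ∈ polyFun N :=
  ⟨MvPolynomial.C a, funext fun _ => MvPolynomial.eval_C a⟩

theorem coord_mem_polyFun (i : Fin N) : (fun ρ => ρ i) ∈ polyFun N :=
  ⟨MvPolynomial.X i, funext fun _ => MvPolynomial.eval_X i⟩

theorem mul_mem_polyFun {f g : (Fin N → ℝ) → ℝ} (hf : f ∈ polyFun N) (hg : g ∈ polyFun N) :
    (fun ρ => f ρ * g ρ) ∈ polyFun N :=
  mul_mem hf hg

theorem sub_mem_polyFun {f g : (Fin N → ℝ) → ℝ} (hf : f ∈ polyFun N) (hg : g ∈ polyFun N) :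
    (fun ρ => f ρ - g ρ) ∈ polyFun N :=
  sub_mem hf hg

theorem sum_mem_polyFun {ι : Type*} {s : Finset ι} {f : ι → (Fin N → ℝ) → ℝ}
    (hf : ∀ i, f i ∈ polyFun N) : (fun ρ => ∑ i ∈ s, f i ρ) ∈ polyFun N := by
  have := sum_mem (S := polyFun N) (t := s) fun i _ => hf i
  convert this using 1
  ext ρ
  simp

theorem prod_mem_polyFun {ι : Type*} {s : Finset ι} {f : ι → (Fin N → ℝ) → ℝ}
    (hf : ∀ i, f i ∈ polyFun N) : (fun ρ => ∏ i ∈ s, f i ρ) ∈ polyFun N := by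
  have := prod_mem (S := polyFun N) (t := s) fun i _ => hf i
  convert this using 1
  ext ρ
  simp

theorem det_mem_polyFun {m : ℕ} {M : (Fin N → ℝ) → Matrix (Fin m) (Fin m) ℝ}
    (hM : ∀ i j, (fun ρ => M ρ i j) ∈ polyFun N) : (fun ρ => (M ρ).det) ∈ polyFun N := by
  simp only [det_apply']
  exact sum_mem_polyFun fun σ => mul_mem_polyFun (const_mem_polyFun _)
    (prod_mem_polyFun fun i => hM _ _)

end PolyFun

/-- Labels of the mixing coefficients: a compression matrix and two vectors. -/
abbrev MixIndex (h K : ℕ) : Type := (Fin (h + 1) × Fin K) ⊕ Fin (h + 1) ⊕ Fin (h + 1)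

/-- The numbering of the mixing coefficients. -/
def mixEquiv (h K : ℕ) : MixIndex h K ≃ Fin (Fintype.card (MixIndex h K)) := Fintype.equivFin _

section Mix

variable {h K : ℕ} {S : Type*} (ρ : Fin (Fintype.card (MixIndex h K)) → S)

/-- The compression matrix. -/
def mixX : Matrix (Fin (h + 1)) (Fin K) S :=
  Matrix.of fun l κ => ρ (mixEquiv h K (Sum.inl (l, κ)))

/-- The first mixing vector. -/
def mixU (l : Fin (h + 1)) : S := ρ (mixEquiv h K (Sum.inr (Sum.inl l)))

/-- The second mixing vector. -/
def mixW (l : Fin (h + 1)) : S := ρ (mixEquiv h K (Sum.inr (Sum.inr l)))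

theorem exists_mix (X : Matrix (Fin (h + 1)) (Fin K) S) (u w : Fin (h + 1) → S) :
    ∃ ρ, mixX ρ = X ∧ mixU (K := K) ρ = u ∧ mixW (K := K) ρ = w := by
  refine ⟨fun i => Sum.elim (fun q : Fin (h + 1) × Fin K => X q.1 q.2) (Sum.elim u w)
    ((mixEquiv h K).symm i), ?_, ?_, ?_⟩
  · ext l κ; simp [mixX]
  · ext l; simp [mixU]
  · ext l; simp [mixW]

end Mix

/-! ### The points as polynomials in the mixing coefficients -/

section Cofactor

variable {h R p : ℕ} {C : Matrix (Fin (h + 1)) (Fin R) ℝ}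

/-- The generalized cross product of the columns `g 0, …, g (h - 1)` of `C`. -/
def crossVec (C : Matrix (Fin (h + 1)) (Fin R) ℝ) (g : Fin h → Fin R) (l : Fin (h + 1)) : ℝ :=
  (-1) ^ (l : ℕ) * (C.submatrix l.succAbove g).det

theorem crossVec_vecMul (C : Matrix (Fin (h + 1)) (Fin R) ℝ) (g : Fin h → Fin R) (r : Fin R) :
    (crossVec C g ᵥ* C) r =
      (C.submatrix id (Fin.cons r g : Fin (h + 1) → Fin R)).det := by
  rw [det_succ_column_zero]
  simp only [vecMul, dotProduct, crossVec]
  refine Finset.sum_congr rfl fun l _ => ?_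
  have : (C.submatrix id (Fin.cons r g : Fin (h + 1) → Fin R)).submatrix l.succAbove Fin.succ =
      C.submatrix l.succAbove g := by
    ext a b; simp
  rw [this]
  simp
  ring

theorem genPos_of_det_ne_zero
    (hC : ∀ f : Fin (h + 1) → Fin R, Function.Injective f → (C.submatrix id f).det ≠ 0) :
    GenPos C := by
  intro y hy
  by_contra! hlt
  obtain ⟨Z, hZ, hZc⟩ := exists_subset_card_eq (Nat.succ_le_of_lt hlt)
  refine hy (Matrix.eq_zero_of_vecMul_eq_zero (hC _ (Z.orderEmbOfFin hZc).injective) ?_)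
  ext j
  have := hZ (Z.orderEmbOfFin_mem hZc j)
  rw [mem_filter_univ] at this
  exact this

theorem card_compl_eq (hpR : p + h = R) (Ω : {S : Finset (Fin R) // #S = p}) : #(Ω.1ᶜ) = h := by
  rw [card_compl, Ω.2, Fintype.card_fin]
  omega

/-- The vector orthogonal to the columns outside `Ω`. -/
def crossCompl (hpR : p + h = R) (C : Matrix (Fin (h + 1)) (Fin R) ℝ)
    (Ω : {S : Finset (Fin R) // #S = p}) : Fin (h + 1) → ℝ :=
  crossVec C (Ω.1ᶜ.orderEmbOfFin (card_compl_eq hpR Ω))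

theorem crossCompl_vecMul_eq_zero_iff (hpR : p + h = R)
    (hC : ∀ f : Fin (h + 1) → Fin R, Function.Injective f → (C.submatrix id f).det ≠ 0)
    (Ω : {S : Finset (Fin R) // #S = p}) (r : Fin R) :
    (crossCompl hpR C Ω ᵥ* C) r = 0 ↔ r ∉ Ω.1 := by
  rw [crossCompl, crossVec_vecMul]
  constructor
  · intro h0 hr
    refine hC _ (Fin.cons_injective_iff.2 ⟨?_, (orderEmbOfFin _ _).injective⟩) h0
    simpa using hr
  · intro hr
    obtain ⟨j, hj⟩ : r ∈ Set.range (Ω.1ᶜ.orderEmbOfFin (card_compl_eq hpR Ω)) := by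
      simpa using hr
    refine det_zero_of_column_eq (i := 0) (j := j.succ) (Fin.succ_ne_zero j).symm fun l => ?_
    simp [hj]

end Cofactor

theorem det_transpose_mul_self_ne_zero {m n : Type*} [Fintype m] [Fintype n] [DecidableEq n]
    {M : Matrix m n ℝ} (hM : LinearIndependent ℝ M.col) : (Mᵀ * M).det ≠ 0 := by
  intro h0
  obtain ⟨v, hv, h1⟩ := Matrix.exists_mulVec_eq_zero_iff.2 h0
  have h2 : M *ᵥ v = 0 := by
    rw [← dotProduct_self_eq_zero, dotProduct_mulVec, ← mulVec_transpose, mulVec_mulVec, h1,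
      zero_dotProduct]
  exact hv (Matrix.mulVec_injective_iff.2 hM (by rw [h2, mulVec_zero]))

/-- Generic mixing coefficients, adapted to the matrix `C`. -/
structure GoodMix {h K R : ℕ} (p : ℕ) (C : Matrix (Fin K) (Fin R) ℝ)
    (ρ : Fin (Fintype.card (MixIndex h K)) → ℝ)
    (x : {S : Finset (Fin R) // #S = p} → Fin (h + 1) → ℝ) : Prop where
  genPos : GenPos (mixX ρ * C)
  zeros : ∀ Ω r, (x Ω ᵥ* (mixX ρ * C)) r = 0 ↔ r ∉ Ω.1
  ne_zero : ∀ Ω, mixW (K := K) ρ ⬝ᵥ x Ω ≠ 0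
  separated : ∀ Ω Ω', Ω ≠ Ω' → (mixU (K := K) ρ ⬝ᵥ x Ω) * (mixW (K := K) ρ ⬝ᵥ x Ω') ≠
    (mixU (K := K) ρ ⬝ᵥ x Ω') * (mixW (K := K) ρ ⬝ᵥ x Ω)

/-- With the points given by cofactors, all conditions say that polynomials in ρ do not vanish, so
one suitable ρ for each is enough. -/
theorem ae_goodMix {h K R p : ℕ} (hpR : p + h = R) (hp : 1 ≤ p) (C : Matrix (Fin K) (Fin R) ℝ)
    (hC : ∀ f : Fin (h + 1) → Fin R, Function.Injective f →
      LinearIndependent ℝ fun j => C.col (f j)) :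
    ∀ᵐ ρ : Fin (Fintype.card (MixIndex h K)) → ℝ, ∃ x, GoodMix p C ρ x := by
  have hX : ∀ l r, (fun ρ : Fin (Fintype.card (MixIndex h K)) → ℝ => (mixX ρ * C) l r) ∈
      polyFun _ := fun l r => by
    simp only [mul_apply, mixX, of_apply]
    exact sum_mem_polyFun fun κ => mul_mem_polyFun (coord_mem_polyFun _) (const_mem_polyFun _)
  have hx : ∀ (Ω : {S : Finset (Fin R) // #S = p}) l,
      (fun ρ : Fin (Fintype.card (MixIndex h K)) → ℝ => crossCompl hpR (mixX ρ * C) Ω l) ∈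
        polyFun _ := fun Ω l =>
    mul_mem_polyFun (const_mem_polyFun _) (det_mem_polyFun fun i j => hX _ _)
  have hw : ∀ Ω : {S : Finset (Fin R) // #S = p},
      (fun ρ : Fin (Fintype.card (MixIndex h K)) → ℝ =>
        mixW (K := K) ρ ⬝ᵥ crossCompl hpR (mixX ρ * C) Ω) ∈ polyFun _ := fun Ω =>
    sum_mem_polyFun fun l => mul_mem_polyFun (coord_mem_polyFun _) (hx Ω l)
  have hu : ∀ Ω : {S : Finset (Fin R) // #S = p},
      (fun ρ : Fin (Fintype.card (MixIndex h K)) → ℝ =>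
        mixU (K := K) ρ ⬝ᵥ crossCompl hpR (mixX ρ * C) Ω) ∈ polyFun _ := fun Ω =>
    sum_mem_polyFun fun l => mul_mem_polyFun (coord_mem_polyFun _) (hx Ω l)
  have h1 : ∀ᵐ ρ : Fin (Fintype.card (MixIndex h K)) → ℝ, ∀ f : Fin (h + 1) → Fin R,
      Function.Injective f → ((mixX ρ * C).submatrix id f).det ≠ 0 := by
    rw [ae_all_iff]
    intro f
    by_cases hf : Function.Injective f
    · simp only [hf, true_implies]
      refine ae_ne_zero_of_mem_polyFun (det_mem_polyFun fun i j => hX _ _) ?_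
      -- Compression by the transposed columns themselves makes the minor a Gram determinant.
      obtain ⟨ρ, hρ, -⟩ := exists_mix (C.submatrix id f)ᵀ 0 0
      refine ⟨ρ, ?_⟩
      have : ((mixX ρ * C).submatrix id f) = (C.submatrix id f)ᵀ * C.submatrix id f := by
        rw [hρ]
        rfl
      rw [this]
      exact det_transpose_mul_self_ne_zero (hC f hf)
    · simp [hf]
  obtain ⟨ρ₀, hρ₀⟩ := h1.exists
  have hz₀ := crossCompl_vecMul_eq_zero_iff hpR hρ₀
  have hdot : ∀ Ω r, (fun l => (mixX ρ₀ * C) l r) ⬝ᵥ crossCompl hpR (mixX ρ₀ * C) Ω = 0 ↔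
      r ∉ Ω.1 := fun Ω r => by
    rw [dotProduct_comm]
    exact hz₀ Ω r
  have h2 : ∀ᵐ ρ : Fin (Fintype.card (MixIndex h K)) → ℝ,
      ∀ Ω : {S : Finset (Fin R) // #S = p},
        mixW (K := K) ρ ⬝ᵥ crossCompl hpR (mixX ρ * C) Ω ≠ 0 := by
    rw [ae_all_iff]
    intro Ω
    refine ae_ne_zero_of_mem_polyFun (hw Ω) ?_
    obtain ⟨r, hr⟩ := card_pos.1 (show 0 < #Ω.1 by rw [Ω.2]; omega)
    -- The witness w is a compressed column in Ω, to which the point of Ω is not orthogonal.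
    obtain ⟨ρ, hρ, -, hρw⟩ := exists_mix (mixX ρ₀) 0 fun l => (mixX ρ₀ * C) l r
    refine ⟨ρ, ?_⟩
    rw [hρ, hρw, Ne, hdot]
    simpa using hr
  have h3 : ∀ᵐ ρ : Fin (Fintype.card (MixIndex h K)) → ℝ,
      ∀ Ω Ω' : {S : Finset (Fin R) // #S = p}, Ω ≠ Ω' →
        (mixU (K := K) ρ ⬝ᵥ crossCompl hpR (mixX ρ * C) Ω) *
            (mixW (K := K) ρ ⬝ᵥ crossCompl hpR (mixX ρ * C) Ω') -
          (mixU (K := K) ρ ⬝ᵥ crossCompl hpR (mixX ρ * C) Ω') *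
            (mixW (K := K) ρ ⬝ᵥ crossCompl hpR (mixX ρ * C) Ω) ≠ 0 := by
    rw [ae_all_iff]
    intro Ω
    rw [ae_all_iff]
    intro Ω'
    by_cases hne : Ω = Ω'
    · simp [hne]
    simp only [ne_eq, hne, not_false_eq_true, true_implies]
    refine ae_ne_zero_of_mem_polyFun (sub_mem_polyFun (mul_mem_polyFun (hu Ω) (hw Ω'))
      (mul_mem_polyFun (hu Ω') (hw Ω))) ?_
    have hsub : ∀ Ω Ω' : {S : Finset (Fin R) // #S = p}, Ω ≠ Ω' → ∃ r ∈ Ω.1, r ∉ Ω'.1 := by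
      intro Ω Ω' hne
      by_contra! hall
      exact hne (Subtype.ext (eq_of_subset_of_card_le hall (by rw [Ω.2, Ω'.2])))
    obtain ⟨r, hr, hr'⟩ := hsub Ω Ω' hne
    obtain ⟨q, hq, hq'⟩ := hsub Ω' Ω (Ne.symm hne)
    -- With u and w compressed columns from Ω \ Ω' and Ω' \ Ω, the second product vanishes and the
    -- first does not.
    obtain ⟨ρ, hρ, hρu, hρw⟩ := exists_mix (mixX ρ₀) (fun l => (mixX ρ₀ * C) l r)
      fun l => (mixX ρ₀ * C) l q
    refine ⟨ρ, ?_⟩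
    rw [hρ, hρu, hρw, (hdot Ω' r).2 hr', zero_mul, sub_zero]
    exact mul_ne_zero ((hdot Ω r).not.2 (not_not.2 hr)) ((hdot Ω' q).not.2 (not_not.2 hq))
  filter_upwards [h1, h2, h3] with ρ h1 h2 h3
  exact ⟨crossCompl hpR (mixX ρ * C), genPos_of_det_ne_zero h1,
    crossCompl_vecMul_eq_zero_iff hpR h1, h2, fun Ω Ω' hne => sub_ne_zero.1 (h3 Ω Ω' hne)⟩

/-! ### Uniqueness of the decomposition -/

theorem kRank_le {m R : ℕ} (M : Matrix (Fin m) (Fin R) ℝ) : kRank M ≤ R :=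
  csSup_le ⟨0, by simp, fun S hS => by
    rw [card_eq_zero] at hS
    subst hS
    exact linearIndependent_empty_type⟩ fun _ hk => hk.1

theorem linearIndependent_of_kRank {m R k : ℕ} {M : Matrix (Fin m) (Fin R) ℝ} (hk : kRank M = k)
    {f : Fin k → Fin R} (hf : Function.Injective f) :
    LinearIndependent ℝ fun j => M.col (f j) := by
  have hmem : kRank M ∈ {k : ℕ | k ≤ R ∧
      ∀ S : Finset (Fin R), #S = k → LinearIndependent ℝ (fun r : S => M.col r)} :=
    Nat.sSup_mem ⟨0, by simp, fun S hS => by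
      rw [card_eq_zero] at hS
      subst hS
      exact linearIndependent_empty_type⟩ ⟨R, fun _ hk => hk.1⟩
  have := hmem.2 (univ.image f) (by rw [card_image_of_injective _ hf, hk]; simp)
  exact this.comp (fun j => ⟨f j, mem_image_of_mem f (mem_univ j)⟩)
    fun i j hij => hf (by simpa using hij)

section Decomposition

variable {I J K R : ℕ} {A A' : Matrix (Fin I) (Fin R) ℝ} {B B' : Matrix (Fin J) (Fin R) ℝ}
  {C C' : Matrix (Fin K) (Fin R) ℝ}

theorem sum_mul_cpTensor (A : Matrix (Fin I) (Fin R) ℝ) (B : Matrix (Fin J) (Fin R) ℝ)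
    (C : Matrix (Fin K) (Fin R) ℝ) (w : Fin K → ℝ) (i : Fin I) (j : Fin J) :
    ∑ κ, w κ * cpTensor A B C i j κ = diagForm A B (w ᵥ* C) i j := by
  simp only [cpTensor, diagForm, of_apply, vecMul, dotProduct, Finset.mul_sum]
  rw [Finset.sum_comm]
  exact Finset.sum_congr rfl fun r _ => Finset.sum_congr rfl fun κ _ => by ring

theorem diagForm_eq_of_cpTensor_eq (hT : cpTensor A B C = cpTensor A' B' C') (w : Fin K → ℝ) :
    diagForm A B (w ᵥ* C) = diagForm A' B' (w ᵥ* C') := by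
  ext i j
  rw [← sum_mul_cpTensor, hT, sum_mul_cpTensor]

/-- The third factor is determined by the first two. -/
theorem FullColumnRank.third_factor_eq (h : FullColumnRank (khatriRao A B))
    (hT : cpTensor A B C = cpTensor A B C') : C = C' := by
  ext κ r
  have := h.eq_zero_of_sum (c := fun r => C κ r - C' κ r) (fun i j => by
    have := congrFun (congrFun (congrFun hT i) j) κ
    simp only [cpTensor] at this
    simp only [mul_sub, Finset.sum_sub_distrib, this, sub_self])
  exact sub_eq_zero.1 (congrFun this r)

/-- One good compression identifies A' and B'; the third factor is then recovered from the
uncompressed tensor. -/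
theorem cpdEquiv_of_cpTensor_eq {h p : ℕ} (hpR : p + h = R) (hp : 1 ≤ p) (hh : 1 ≤ h)
    (hk : kRank C = h + 1)
    (hAB : FullColumnRank (khatriRao (compound (p + 1) A) (compound (p + 1) B)))
    (hT : cpTensor A B C = cpTensor A' B' C') : CPDEquiv A B C A' B' C' := by
  obtain ⟨ρ, x, hx⟩ := (ae_goodMix hpR hp C fun f hf => linearIndependent_of_kRank hk hf).exists
  obtain ⟨π, hA, hB⟩ := exists_perm_factors hpR hp hh hAB (C' := mixX ρ * C') hx.genPos
    fun y => by
      rw [← vecMul_vecMul, ← vecMul_vecMul]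
      exact diagForm_eq_of_cpTensor_eq hT _
  choose a ha haA using hA
  choose b hb hbB using hB
  have hC : C = Matrix.of fun κ r => a (π.symm r) * b (π.symm r) * C' κ (π.symm r) := by
    refine (hAB.of_compound (by omega) (by omega)).third_factor_eq (hT.trans ?_)
    ext i j κ
    simp only [cpTensor, of_apply]
    refine Fintype.sum_equiv π _ _ fun r => ?_
    rw [haA, hbB, Equiv.symm_apply_apply]
    ring
  refine ⟨π, a, b, fun r => (a r * b r)⁻¹, fun r => ⟨mul_inv_cancel₀ (mul_ne_zero (ha r) (hb r)),
    funext fun i => haA r i, funext fun j => hbB r j, funext fun κ => ?_⟩⟩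
  have := ha r
  have := hb r
  simp only [col_apply, Pi.smul_apply, smul_eq_mul]
  rw [hC]
  simp only [of_apply, Equiv.symm_apply_apply]
  field_simp

theorem cpTensor_append_zero {R' : ℕ} (e : Fin R' → Fin R) (he : Function.Injective e)
    (A' : Matrix (Fin I) (Fin R') ℝ) (B' : Matrix (Fin J) (Fin R') ℝ)
    (C' : Matrix (Fin K) (Fin R') ℝ) :
    cpTensor (Matrix.of fun i => Function.extend e (A' i) 0)
      (Matrix.of fun i => Function.extend e (B' i) 0)
      (Matrix.of fun i => Function.extend e (C' i) 0) = cpTensor A' B' C' := by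
  ext i j κ
  simp only [cpTensor, of_apply]
  symm
  refine Fintype.sum_of_injective e he _ _ (fun r hr => ?_) fun r => ?_
  · rw [Function.extend_apply' _ _ _ (by simpa using hr)]
    simp
  · simp [he.extend_apply]

/-- Padding a shorter decomposition to R terms gives a zero column, but it would be equivalent to
one whose first factor has none. -/
theorem tensorRank_cpTensor {h p : ℕ} (hpR : p + h = R) (hp : 1 ≤ p) (hh : 1 ≤ h)
    (hk : kRank C = h + 1)
    (hAB : FullColumnRank (khatriRao (compound (p + 1) A) (compound (p + 1) B))) :
    tensorRank (cpTensor A B C) = R := by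
  refine le_antisymm (Nat.sInf_le ⟨A, B, C, rfl⟩) (le_csInf ⟨R, A, B, C, rfl⟩ ?_)
  rintro R' ⟨A', B', C', hT⟩
  by_contra! hlt
  obtain ⟨π, a, b, c, hπ⟩ := cpdEquiv_of_cpTensor_eq hpR hp hh hk hAB
    (hT.symm.trans (cpTensor_append_zero (Fin.castLE hlt.le) (Fin.castLE_injective _) A' B' C').symm)
  obtain ⟨habc, hA, -⟩ := hπ ⟨R', hlt⟩
  obtain ⟨i, hi⟩ := hAB.allMinors_left.exists_ne_zero (by omega) (π ⟨R', hlt⟩)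
  have h0 := congrFun hA i
  simp only [col_apply, of_apply, Pi.smul_apply, smul_eq_mul] at h0
  rw [Function.extend_apply' _ _ _ (by
    rintro ⟨q, hq⟩
    have := congrArg Fin.val hq
    simp at this
    omega)] at h0
  have ha : a ⟨R', hlt⟩ ≠ 0 := by
    intro h0
    simp [h0] at habc
  exact mul_ne_zero ha hi h0.symm

theorem CPDEquiv.symm (h : CPDEquiv A B C A' B' C') : CPDEquiv A' B' C' A B C := by
  obtain ⟨π, a, b, c, hπ⟩ := h
  refine ⟨π.symm, fun r => (a (π.symm r))⁻¹, fun r => (b (π.symm r))⁻¹, fun r => (c (π.symm r))⁻¹, fun r => ?_⟩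
  obtain ⟨h1, h2, h3, h4⟩ := hπ (π.symm r)
  rw [Equiv.apply_symm_apply] at h2 h3 h4
  have ha : a (π.symm r) ≠ 0 := by intro h0; simp [h0] at h1
  have hb : b (π.symm r) ≠ 0 := by intro h0; simp [h0] at h1
  have hc : c (π.symm r) ≠ 0 := by intro h0; simp [h0] at h1
  refine ⟨?_, ?_, ?_, ?_⟩
  · rw [← mul_inv, ← mul_inv, h1, inv_one]
  · rw [h2, inv_smul_smul₀ ha]
  · rw [h3, inv_smul_smul₀ hb]
  · rw [h4, inv_smul_smul₀ hc]

theorem CPDEquiv.trans {A'' : Matrix (Fin I) (Fin R) ℝ} {B'' : Matrix (Fin J) (Fin R) ℝ}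
    {C'' : Matrix (Fin K) (Fin R) ℝ} (h : CPDEquiv A B C A' B' C')
    (h' : CPDEquiv A' B' C' A'' B'' C'') : CPDEquiv A B C A'' B'' C'' := by
  obtain ⟨π, a, b, c, hπ⟩ := h
  obtain ⟨π', a', b', c', hπ'⟩ := h'
  refine ⟨π'.trans π, fun r => a' r * a (π' r), fun r => b' r * b (π' r),
    fun r => c' r * c (π' r), fun r => ?_⟩
  obtain ⟨h1, h2, h3, h4⟩ := hπ (π' r)
  obtain ⟨h1', h2', h3', h4'⟩ := hπ' r
  refine ⟨?_, ?_, ?_, ?_⟩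
  · linear_combination a' r * b' r * c' r * h1 + h1'
  · rw [h2', h2, smul_smul]; rfl
  · rw [h3', h3, smul_smul]; rfl
  · rw [h4', h4, smul_smul]; rfl

theorem cpdUnique_cpTensor {h p : ℕ} (hpR : p + h = R) (hp : 1 ≤ p) (hh : 1 ≤ h)
    (hk : kRank C = h + 1)
    (hAB : FullColumnRank (khatriRao (compound (p + 1) A) (compound (p + 1) B))) :
    CPDUnique (cpTensor A B C) := by
  intro R' A₁ A₂ B₁ B₂ C₁ C₂ h₁ h₂
  have hR : R = R' := (tensorRank_cpTensor hpR hp hh hk hAB).symm.trans h₁.2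
  subst hR
  exact (cpdEquiv_of_cpTensor_eq hpR hp hh hk hAB h₁.1.symm).symm.trans
    (cpdEquiv_of_cpTensor_eq hpR hp hh hk hAB h₂.1.symm)

end Decomposition

/-! ### Execution of procedures -/

theorem Procedure.Ensures.mono {P : Procedure} {Q Q' : Memory → Prop} (hQ : ∀ σ, Q σ → Q' σ)
    {σ : Memory} (h : P.Ensures Q σ) : P.Ensures Q' σ := by
  induction P generalizing Q Q' σ with
  | skip => exact hQ _ h
  | seq P P' ih ih' => exact ih (fun τ hτ => ih' hQ hτ) h
  | poly x m n p => exact hQ _ h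
  | inverse x n M => exact ⟨h.1, hQ _ h.2⟩
  | orthCompl x m n d M => exact ⟨h.1, fun N hN => hQ _ (h.2 N hN)⟩
  | gevd x y p M N => exact ⟨h.1, fun V E hV => hQ _ (h.2 V E hV)⟩
  | ifZero c P P' ih ih' => exact ⟨fun h0 => ih hQ (h.1 h0), fun h0 => ih' hQ (h.2 h0)⟩

theorem Memory.write_apply_of_ne {m n : ℕ} (σ : Memory) {x : ℕ} (M : Matrix (Fin m) (Fin n) ℝ)
    {c : Cell} (hc : c.1 ≠ x) : σ.write x M c = σ c :=
  if_neg hc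

theorem Memory.write_apply_self {m n : ℕ} (σ : Memory) (x : ℕ) (M : Matrix (Fin m) (Fin n) ℝ)
    (i : Fin m) (j : Fin n) : σ.write x M (x, (i : ℕ), (j : ℕ)) = M i j := by
  simp [Memory.write]

theorem Memory.read_write_self {m n : ℕ} (σ : Memory) (x : ℕ) (M : Matrix (Fin m) (Fin n) ℝ) :
    (σ.write x M).read x m n = M := by
  ext i j
  exact σ.write_apply_self x M i j

theorem Memory.read_write_of_ne {m n m' n' : ℕ} (σ : Memory) {x y : ℕ} (hxy : y ≠ x)
    (M : Matrix (Fin m) (Fin n) ℝ) : (σ.write x M).read y m' n' = σ.read y m' n' := by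
  ext i j
  exact σ.write_apply_of_ne M hxy

/-- The cells of the register `x`. -/
def regCells (x m n : ℕ) : Matrix (Fin m) (Fin n) Cell :=
  Matrix.of fun i j => (x, (i : ℕ), (j : ℕ))

theorem regCells_map (σ : Memory) (x m n : ℕ) : (regCells x m n).map σ = σ.read x m n := rfl

/-- The content of the register `x` as a matrix of polynomials. -/
def regPoly (x m n : ℕ) : Matrix (Fin m) (Fin n) (MvPolynomial Cell ℚ) :=
  (regCells x m n).map MvPolynomial.X

/-- Evaluation of polynomials in the memory cells. -/
def evalAt (σ : Memory) : MvPolynomial Cell ℚ →+* ℝ := (MvPolynomial.aeval σ : _ →ₐ[ℚ] ℝ)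

theorem map_aeval {m n : ℕ} (σ : Memory) (p : Matrix (Fin m) (Fin n) (MvPolynomial Cell ℚ)) :
    p.map (MvPolynomial.aeval σ) = p.map (evalAt σ) := rfl

theorem regPoly_map (σ : Memory) (x m n : ℕ) :
    (regPoly x m n).map (evalAt σ) = σ.read x m n := by
  ext i j
  exact MvPolynomial.aeval_X σ _

/-! ### The formulas evaluated by the procedure -/

section Formulas

variable {S S' : Type*} [CommRing S] [CommRing S'] (φ : S →+* S') {I J K R h p : ℕ}

/-- The slices of the compressed tensor. -/
def compSlice (ρ : Fin (Fintype.card (MixIndex h K)) → S) (T : Fin K → Matrix (Fin I) (Fin J) S)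
    (l : Fin (h + 1)) (i : Fin I) (j : Fin J) : S :=
  ∑ κ, mixX ρ l κ * T κ i j

/-- Each formula is stated over any commutative ring, so that it serves both as a polynomial in the
memory cells and as its real value; the `map_` lemmas link the two. -/
theorem map_compSlice (ρ : Fin (Fintype.card (MixIndex h K)) → S)
    (T : Fin K → Matrix (Fin I) (Fin J) S) (l : Fin (h + 1)) (i : Fin I) (j : Fin J) :
    φ (compSlice ρ T l i j) = compSlice (fun a => φ (ρ a)) (fun κ => (T κ).map φ) l i j := by
  simp [compSlice, mixX]

/-- The number of monomials of degree `n` in `h + 1` variables. -/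
abbrev numMon (h n : ℕ) : ℕ := Fintype.card (Sym (Fin (h + 1)) n)

/-- The numbering of the monomials. -/
def monEquiv (h n : ℕ) : Sym (Fin (h + 1)) n ≃ Fin (numMon h n) := Fintype.equivFin _

/-- The labels of the minors of size `n`. -/
abbrev MinorIndex (I J n : ℕ) : Type := (Fin n ↪o Fin I) × (Fin n ↪o Fin J)

/-- The numbering of the minors. -/
def minorEquiv (I J n : ℕ) : MinorIndex I J n ≃ Fin (Fintype.card (MinorIndex I J n)) :=
  Fintype.equivFin _

/-- The coefficients of the minors of the compressed tensor. -/
def minorMatrix (p : ℕ) (ρ : Fin (Fintype.card (MixIndex h K)) → S)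
    (T : Fin K → Matrix (Fin I) (Fin J) S) :
    Matrix (Fin (numMon h (p + 1))) (Fin (Fintype.card (MinorIndex I J (p + 1)))) S :=
  Matrix.of fun a b => minorCoeff (compSlice ρ T) ((minorEquiv I J (p + 1)).symm b).1
    ((minorEquiv I J (p + 1)).symm b).2 ((monEquiv h (p + 1)).symm a)

theorem map_minorMatrix (ρ : Fin (Fintype.card (MixIndex h K)) → S)
    (T : Fin K → Matrix (Fin I) (Fin J) S) :
    (minorMatrix p ρ T).map φ = minorMatrix p (fun a => φ (ρ a)) fun κ => (T κ).map φ := by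
  ext a b
  simp only [minorMatrix, map_apply, of_apply, map_minorCoeff, map_compSlice]

/-- The contraction of the symmetric tensors in the columns of `N` by `u`. -/
def pencil (u : Fin (h + 1) → S) (N : Matrix (Fin (numMon h (p + 1))) (Fin (numMon h p)) S) :
    Matrix (Fin (numMon h p)) (Fin (numMon h p)) S :=
  Matrix.of fun b j => ∑ l, u l * N (monEquiv h (p + 1) (l ::ₛ (monEquiv h p).symm b)) j

theorem map_pencil (u : Fin (h + 1) → S)
    (N : Matrix (Fin (numMon h (p + 1))) (Fin (numMon h p)) S) :
    (pencil u N).map φ = pencil (fun l => φ (u l)) (N.map φ) := by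
  ext a b
  simp [pencil]

/-- A vector read off from the `e`-th symmetric tensor in `N * V`. -/
def pointVec (N : Matrix (Fin (numMon h (p + 1))) (Fin (numMon h p)) S)
    (V : Matrix (Fin (numMon h p)) (Fin (numMon h p)) S)
    (e : Fin (numMon h p) × Fin (numMon h p)) (l : Fin (h + 1)) : S :=
  ∑ j, N (monEquiv h (p + 1) (l ::ₛ (monEquiv h p).symm e.2)) j * V j e.1

/-- The slice of the compressed tensor in the direction of `pointVec N V e`. -/
def pointSlice (ρ : Fin (Fintype.card (MixIndex h K)) → S) (T : Fin K → Matrix (Fin I) (Fin J) S)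
    (N : Matrix (Fin (numMon h (p + 1))) (Fin (numMon h p)) S)
    (V : Matrix (Fin (numMon h p)) (Fin (numMon h p)) S)
    (e : Fin (numMon h p) × Fin (numMon h p)) : Matrix (Fin I) (Fin J) S :=
  Matrix.of fun i j => ∑ l, pointVec N V e l * compSlice ρ T l i j

theorem map_pointSlice (ρ : Fin (Fintype.card (MixIndex h K)) → S)
    (T : Fin K → Matrix (Fin I) (Fin J) S)
    (N : Matrix (Fin (numMon h (p + 1))) (Fin (numMon h p)) S)
    (V : Matrix (Fin (numMon h p)) (Fin (numMon h p)) S)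
    (e : Fin (numMon h p) × Fin (numMon h p)) :
    (pointSlice ρ T N V e).map φ =
      pointSlice (fun a => φ (ρ a)) (fun κ => (T κ).map φ) (N.map φ) (V.map φ) e := by
  ext i j
  simp [pointSlice, pointVec, map_compSlice]

theorem map_borderedMinor (M N : Matrix (Fin I) (Fin J) S) (s : Fin p → Fin I)
    (t : Fin (p + 1) → Fin J) (i : Fin I) :
    φ (borderedMinor M N s t i) = borderedMinor (M.map φ) (N.map φ) s t i := by
  rw [borderedMinor, RingHom.map_det, borderedMinor]
  congr 1
  ext a l
  refine Fin.cases ?_ (fun a => ?_) a <;> simp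

/-- The choices that determine how one term of the decomposition is computed: two points, the row
and column indices of the minor for the first factor, and those for the second factor. -/
abbrev TermChoice (I J h p : ℕ) : Type :=
  ((Fin (numMon h p) × Fin (numMon h p)) × (Fin (numMon h p) × Fin (numMon h p))) ×
    ((Fin p → Fin I) × (Fin (p + 1) → Fin J)) × ((Fin p → Fin J) × (Fin (p + 1) → Fin I))

section Factors

variable (ρ : Fin (Fintype.card (MixIndex h K)) → S) (T : Fin K → Matrix (Fin I) (Fin J) S)
  (N : Matrix (Fin (numMon h (p + 1))) (Fin (numMon h p)) S)
  (V : Matrix (Fin (numMon h p)) (Fin (numMon h p)) S) (c : Fin R → TermChoice I J h p)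

/-- The candidate for the first factor matrix. -/
def firstFactor : Matrix (Fin I) (Fin R) S :=
  Matrix.of fun i r => borderedMinor (pointSlice ρ T N V (c r).1.1) (pointSlice ρ T N V (c r).1.2)
    (c r).2.1.1 (c r).2.1.2 i

/-- The candidate for the second factor matrix. -/
def secondFactor : Matrix (Fin J) (Fin R) S :=
  Matrix.of fun j r => borderedMinor (pointSlice ρ T N V (c r).1.1)ᵀ
    (pointSlice ρ T N V (c r).1.2)ᵀ (c r).2.2.1 (c r).2.2.2 j

theorem map_firstFactor : (firstFactor ρ T N V c).map φ =
    firstFactor (fun a => φ (ρ a)) (fun κ => (T κ).map φ) (N.map φ) (V.map φ) c := by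
  ext i r
  simp only [firstFactor, map_apply, of_apply, map_borderedMinor, map_pointSlice]

theorem map_secondFactor : (secondFactor ρ T N V c).map φ =
    secondFactor (fun a => φ (ρ a)) (fun κ => (T κ).map φ) (N.map φ) (V.map φ) c := by
  ext j r
  simp only [secondFactor, map_apply, of_apply, map_borderedMinor, ← map_pointSlice]
  rfl

end Factors

/-- The Gram matrix of the Khatri–Rao product of `A` and `B`. -/
def khatriRaoGram (A : Matrix (Fin I) (Fin R) S) (B : Matrix (Fin J) (Fin R) S) :
    Matrix (Fin R) (Fin R) S :=
  Matrix.of fun r q => (∑ i, A i r * A i q) * ∑ j, B j r * B j q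

theorem map_khatriRaoGram (A : Matrix (Fin I) (Fin R) S) (B : Matrix (Fin J) (Fin R) S) :
    (khatriRaoGram A B).map φ = khatriRaoGram (A.map φ) (B.map φ) := by
  ext r q
  simp [khatriRaoGram]

/-- The least squares solution for the third factor, `H` being the inverse Gram matrix. -/
def thirdFactor (T : Fin K → Matrix (Fin I) (Fin J) S) (A : Matrix (Fin I) (Fin R) S)
    (B : Matrix (Fin J) (Fin R) S) (H : Matrix (Fin R) (Fin R) S) : Matrix (Fin K) (Fin R) S :=
  Matrix.of fun κ r => ∑ q, H r q * ∑ i, ∑ j, A i q * B j q * T κ i j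

theorem map_thirdFactor (T : Fin K → Matrix (Fin I) (Fin J) S) (A : Matrix (Fin I) (Fin R) S)
    (B : Matrix (Fin J) (Fin R) S) (H : Matrix (Fin R) (Fin R) S) :
    (thirdFactor T A B H).map φ =
      thirdFactor (fun κ => (T κ).map φ) (A.map φ) (B.map φ) (H.map φ) := by
  ext κ r
  simp [thirdFactor]

/-- The squared distance between `T` and `[A, B, C]`. -/
def cpResidual (T : Fin K → Matrix (Fin I) (Fin J) S) (A : Matrix (Fin I) (Fin R) S)
    (B : Matrix (Fin J) (Fin R) S) (C : Matrix (Fin K) (Fin R) S) : S :=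
  ∑ κ, ∑ i, ∑ j, (T κ i j - ∑ r, A i r * B j r * C κ r) ^ 2

theorem map_cpResidual (T : Fin K → Matrix (Fin I) (Fin J) S) (A : Matrix (Fin I) (Fin R) S)
    (B : Matrix (Fin J) (Fin R) S) (C : Matrix (Fin K) (Fin R) S) :
    φ (cpResidual T A B C) =
      cpResidual (fun κ => (T κ).map φ) (A.map φ) (B.map φ) (C.map φ) := by
  simp [cpResidual]

end Formulas

/-! ### Correctness of the formulas over the reals -/

section RealFormulas

variable {I J K R h p : ℕ} {A : Matrix (Fin I) (Fin R) ℝ} {B : Matrix (Fin J) (Fin R) ℝ}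
  {C : Matrix (Fin K) (Fin R) ℝ}

/-- The frontal slices of a tensor. -/
def frontal (T : Tensor I J K) (κ : Fin K) : Matrix (Fin I) (Fin J) ℝ :=
  Matrix.of fun i j => T i j κ

/-- A sum of real squares lets a single zero test certify a decomposition. -/
theorem cpResidual_eq_zero_iff (T : Tensor I J K) :
    cpResidual (frontal T) A B C = 0 ↔ cpTensor A B C = T := by
  unfold cpResidual
  constructor
  · intro h0
    ext i j κ
    rw [Finset.sum_eq_zero_iff_of_nonneg fun _ _ => by positivity] at h0
    have h1 := h0 κ (mem_univ _)
    rw [Finset.sum_eq_zero_iff_of_nonneg fun _ _ => by positivity] at h1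
    have h2 := h1 i (mem_univ _)
    rw [Finset.sum_eq_zero_iff_of_nonneg fun _ _ => by positivity] at h2
    exact (sub_eq_zero.1 (pow_eq_zero_iff two_ne_zero |>.1 (h2 j (mem_univ _)))).symm
  · rintro rfl
    simp [frontal, cpTensor]

theorem khatriRaoGram_eq : khatriRaoGram A B = (khatriRao A B)ᵀ * khatriRao A B := by
  ext r q
  simp only [khatriRaoGram, of_apply, mul_apply, transpose_apply, khatriRao, Fintype.sum_prod_type,
    Finset.sum_mul_sum]
  exact Finset.sum_congr rfl fun i _ => Finset.sum_congr rfl fun j _ => by ring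

theorem FullColumnRank.det_khatriRaoGram_ne_zero (hAB : FullColumnRank (khatriRao A B)) :
    (khatriRaoGram A B).det ≠ 0 := by
  rw [khatriRaoGram_eq]
  exact det_transpose_mul_self_ne_zero hAB

/-- Normal equations: contracting the tensor with a_q and b_q gives the Gram matrix times Cᵀ. -/
theorem thirdFactor_cpTensor (hG : (khatriRaoGram A B).det ≠ 0) :
    thirdFactor (frontal (cpTensor A B C)) A B (khatriRaoGram A B)⁻¹ = C := by
  have h1 : ∀ q κ, ∑ i, ∑ j, A i q * B j q * frontal (cpTensor A B C) κ i j =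
      (khatriRaoGram A B * Cᵀ) q κ := by
    intro q κ
    simp only [frontal, cpTensor, of_apply, khatriRaoGram, mul_apply, transpose_apply,
      Finset.mul_sum, Finset.sum_mul]
    rw [Finset.sum_congr rfl fun i _ => Finset.sum_comm, Finset.sum_comm]
    refine Finset.sum_congr rfl fun r _ => ?_
    rw [Finset.sum_comm]
    exact Finset.sum_congr rfl fun j _ => Finset.sum_congr rfl fun i _ => by ring
  ext κ r
  simp only [thirdFactor, of_apply, h1]
  change ((khatriRaoGram A B)⁻¹ * (khatriRaoGram A B * Cᵀ)) r κ = C κ r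
  rw [nonsing_inv_mul_cancel_left _ _ (isUnit_iff_ne_zero.2 hG), transpose_apply]

theorem compSlice_cpTensor (ρ : Fin (Fintype.card (MixIndex h K)) → ℝ) (l : Fin (h + 1)) :
    compSlice ρ (frontal (cpTensor A B C)) l = diagForm A B ((mixX ρ * C) l) := by
  ext i j
  exact sum_mul_cpTensor A B C (mixX ρ l) i j

theorem pointSlice_cpTensor (ρ : Fin (Fintype.card (MixIndex h K)) → ℝ)
    (N : Matrix (Fin (numMon h (p + 1))) (Fin (numMon h p)) ℝ)
    (V : Matrix (Fin (numMon h p)) (Fin (numMon h p)) ℝ)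
    (e : Fin (numMon h p) × Fin (numMon h p)) :
    pointSlice ρ (frontal (cpTensor A B C)) N V e =
      diagForm A B (pointVec N V e ᵥ* (mixX ρ * C)) := by
  ext i j
  simp only [pointSlice, of_apply, compSlice_cpTensor, diagForm, vecMul, dotProduct,
    Finset.mul_sum]
  rw [Finset.sum_comm]
  exact Finset.sum_congr rfl fun r _ => Finset.sum_congr rfl fun l _ => by ring

/-- Candidates that lead to a decomposition. -/
def GoodFactors (T : Tensor I J K) (A : Matrix (Fin I) (Fin R) ℝ) (B : Matrix (Fin J) (Fin R) ℝ) :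
    Prop :=
  FullColumnRank (khatriRao A B) ∧ ∃ C, cpTensor A B C = T

theorem GoodFactors.residual_eq_zero {T : Tensor I J K} (hg : GoodFactors T A B) :
    cpResidual (frontal T) A B (thirdFactor (frontal T) A B (khatriRaoGram A B)⁻¹) = 0 := by
  obtain ⟨hAB, C, rfl⟩ := hg
  rw [thirdFactor_cpTensor hAB.det_khatriRaoGram_ne_zero, cpResidual_eq_zero_iff]

theorem goodFactors_of_scaled {A' : Matrix (Fin I) (Fin R) ℝ} {B' : Matrix (Fin J) (Fin R) ℝ}
    (hAB : FullColumnRank (khatriRao A B)) {a b : Fin R → ℝ} (ha : ∀ r, a r ≠ 0)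
    (hb : ∀ r, b r ≠ 0) (hA : ∀ i r, A' i r = A i r * a r) (hB : ∀ j r, B' j r = B j r * b r) :
    GoodFactors (cpTensor A B C) A' B' := by
  refine ⟨Fintype.linearIndependent_iff.2 fun d hd r => ?_,
    Matrix.of fun κ r => C κ r / (a r * b r), ?_⟩
  · have := hAB.eq_zero_of_sum (c := fun r => a r * b r * d r) (fun i j => by
      have := congrFun hd (i, j)
      simp only [Finset.sum_apply, Pi.smul_apply, smul_eq_mul, khatriRao, col_apply, of_apply, hA,
        hB, Pi.zero_apply] at this
      rw [← this]
      exact Finset.sum_congr rfl fun r _ => by ring)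
    exact (mul_eq_zero.1 (congrFun this r)).resolve_left (mul_ne_zero (ha r) (hb r))
  · ext i j κ
    simp only [cpTensor, of_apply, hA, hB]
    refine Finset.sum_congr rfl fun r _ => ?_
    have := ha r
    have := hb r
    field_simp

/-- Every point `x Ω` is, up to scaling, one of the computed vectors. -/
def FindsPoints (x : {S : Finset (Fin R) // #S = p} → Fin (h + 1) → ℝ)
    (N : Matrix (Fin (numMon h (p + 1))) (Fin (numMon h p)) ℝ)
    (V : Matrix (Fin (numMon h p)) (Fin (numMon h p)) ℝ) : Prop :=
  ∀ Ω, ∃ e, ∃ c : ℝ, c ≠ 0 ∧ pointVec N V e = c • x Ω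

/-- For term r, take p + 1 columns starting with r. The two found points that omit the second,
respectively the first, of these columns isolate a_r, and the transposed slices isolate b_r. -/
theorem exists_goodFactors (hpR : p + h = R) (hp : 1 ≤ p) (hh : 1 ≤ h)
    (hAB : FullColumnRank (khatriRao (compound (p + 1) A) (compound (p + 1) B)))
    {ρ : Fin (Fintype.card (MixIndex h K)) → ℝ}
    {x : {S : Finset (Fin R) // #S = p} → Fin (h + 1) → ℝ}
    (hx : ∀ Ω r, (x Ω ᵥ* (mixX ρ * C)) r = 0 ↔ r ∉ Ω.1)
    {N : Matrix (Fin (numMon h (p + 1))) (Fin (numMon h p)) ℝ}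
    {V : Matrix (Fin (numMon h p)) (Fin (numMon h p)) ℝ} (hNV : FindsPoints x N V) :
    ∃ c : Fin R → TermChoice I J h p, GoodFactors (cpTensor A B C)
      (firstFactor ρ (frontal (cpTensor A B C)) N V c)
      (secondFactor ρ (frontal (cpTensor A B C)) N V c) := by
  have hn : p + 1 ≤ R := by omega
  have hpoint : ∀ Ω : {S : Finset (Fin R) // #S = p}, ∃ e,
      ∀ r, (pointVec N V e ᵥ* (mixX ρ * C)) r = 0 ↔ r ∉ Ω.1 := by
    intro Ω
    obtain ⟨e, c, hc, he⟩ := hNV Ω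
    refine ⟨e, fun r => ?_⟩
    rw [he, smul_vecMul, Pi.smul_apply, smul_eq_mul, mul_eq_zero, ← hx]
    simp [hc]
  have hterm : ∀ r, ∃ c : TermChoice I J h p, ∃ a b : ℝ, a ≠ 0 ∧ b ≠ 0 ∧
      (∀ i, borderedMinor (diagForm A B (pointVec N V c.1.1 ᵥ* (mixX ρ * C)))
        (diagForm A B (pointVec N V c.1.2 ᵥ* (mixX ρ * C))) c.2.1.1 c.2.1.2 i = A i r * a) ∧
      ∀ j, borderedMinor (diagForm A B (pointVec N V c.1.1 ᵥ* (mixX ρ * C)))ᵀ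
        (diagForm A B (pointVec N V c.1.2 ᵥ* (mixX ρ * C)))ᵀ c.2.2.1 c.2.2.2 j = B j r * b := by
    intro r
    obtain ⟨f, hf, rfl⟩ := exists_injective_apply_zero hn r
    have hl : (⟨1, by omega⟩ : Fin (p + 1)) ≠ 0 := by simp [Fin.ext_iff]
    obtain ⟨e₁, he₁⟩ := hpoint ⟨univ.image (f ∘ (⟨1, by omega⟩ : Fin (p + 1)).succAbove), by
      rw [card_image_of_injective _ (hf.comp Fin.succAbove_right_injective)]; simp⟩
    obtain ⟨e₂, he₂⟩ := hpoint ⟨univ.image (f ∘ Fin.succ), by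
      rw [card_image_of_injective _ (hf.comp (Fin.succ_injective _))]; simp⟩
    have hiso := isolates_of_support hl he₁ he₂
    obtain ⟨s, t, a, ha, hst⟩ := hiso.exists_borderedMinor_eq hf hn hAB.allMinors_left
      hAB.allMinors_right
    obtain ⟨s', t', b, hb, hst'⟩ := hiso.exists_borderedMinor_eq hf hn hAB.allMinors_right
      hAB.allMinors_left
    refine ⟨((e₁, e₂), (s, t), (s', t')), a, b, ha, hb, hst, fun j => ?_⟩
    rw [← diagForm_comm, ← diagForm_comm]
    exact hst' j
  choose c a b ha hb hA hB using hterm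
  refine ⟨c, goodFactors_of_scaled (hAB.of_compound hn (by omega)) ha hb (fun i r => ?_)
    fun j r => ?_⟩
  · rw [← hA r i]
    simp only [firstFactor, of_apply, pointSlice_cpTensor]
  · rw [← hB r j]
    simp only [secondFactor, of_apply, pointSlice_cpTensor]

end RealFormulas

/-! ### The points are found by a generalized eigenvalue decomposition -/

section Points

variable {I J K R h p : ℕ} {A : Matrix (Fin I) (Fin R) ℝ} {B : Matrix (Fin J) (Fin R) ℝ}
  {C : Matrix (Fin K) (Fin R) ℝ} {ρ : Fin (Fintype.card (MixIndex h K)) → ℝ}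
  {x : {S : Finset (Fin R) // #S = p} → Fin (h + 1) → ℝ}

/-- The numbering of the points by that of the monomials of degree `p`. -/
def pointEquiv (hpR : p + h = R) : {S : Finset (Fin R) // #S = p} ≃ Fin (numMon h p) :=
  Fintype.equivFinOfCardEq (card_sym_eq_card_subtype hpR).symm

/-- The symmetric powers of order `n` of the points. -/
def momentMatrix (hpR : p + h = R) (n : ℕ)
    (x : {S : Finset (Fin R) // #S = p} → Fin (h + 1) → ℝ) :
    Matrix (Fin (numMon h n)) (Fin (numMon h p)) ℝ :=
  Matrix.of fun a i => moment (x ((pointEquiv hpR).symm i)) ((monEquiv h n).symm a)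

/-- Reindexing of symmetric tensors. -/
def monReindex (h n : ℕ) : (Sym (Fin (h + 1)) n → ℝ) ≃ₗ[ℝ] (Fin (numMon h n) → ℝ) :=
  LinearEquiv.funCongrLeft ℝ ℝ (monEquiv h n).symm

theorem momentMatrix_col (hpR : p + h = R) (n : ℕ) :
    (momentMatrix hpR n x).col = fun i => monReindex h n (moment (x ((pointEquiv hpR).symm i))) :=
  rfl

theorem linearIndependent_momentMatrix_col (hpR : p + h = R) {n : ℕ}
    (hx : LinearIndependent ℝ fun Ω => (moment (x Ω) : Sym (Fin (h + 1)) n → ℝ)) :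
    LinearIndependent ℝ (momentMatrix hpR n x).col := by
  rw [momentMatrix_col]
  exact (hx.comp _ (pointEquiv hpR).symm.injective).map' (monReindex h n).toLinearMap
    (monReindex h n).ker

theorem span_momentMatrix_col (hpR : p + h = R) (n : ℕ) (v : Fin (numMon h n) → ℝ) :
    v ∈ Submodule.span ℝ (Set.range (momentMatrix hpR n x).col) ↔
      (monReindex h n).symm v ∈ Submodule.span ℝ
        (Set.range fun Ω => (moment (x Ω) : Sym (Fin (h + 1)) n → ℝ)) := by
  have : Set.range (momentMatrix hpR n x).col = monReindex h n '' Set.range fun Ω =>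
      (moment (x Ω) : Sym (Fin (h + 1)) n → ℝ) := by
    rw [momentMatrix_col, ← Set.range_comp]
    exact (pointEquiv hpR).symm.surjective.range_comp
      (fun Ω => monReindex h n (moment (x Ω)))
  rw [this]
  exact (Submodule.ext_iff.1 (Submodule.map_span (monReindex h n).toLinearMap _) v).symm.trans
    (Submodule.mem_map_equiv _)

theorem mem_span_momentMatrix_iff (hpR : p + h = R) (hp : 1 ≤ p)
    (hAB : FullColumnRank (khatriRao (compound (p + 1) A) (compound (p + 1) B)))
    (hx : GoodMix p C ρ x) (v : Fin (numMon h (p + 1)) → ℝ) :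
    v ∈ Submodule.span ℝ (Set.range (momentMatrix hpR (p + 1) x).col) ↔
      ∀ j, (minorMatrix p ρ (frontal (cpTensor A B C))).col j ⬝ᵥ v = 0 := by
  rw [span_momentMatrix_col, mem_span_moment_iff hAB hx.genPos hpR hp hx.zeros,
    (minorEquiv I J (p + 1)).symm.forall_congr_left, Prod.forall]
  refine forall_congr' fun s => forall_congr' fun t => ?_
  rw [Equiv.symm_symm]
  have : ∑ α, minorCoeff (fun l => diagForm A B ((mixX ρ * C) l)) s t α *
      (monReindex h (p + 1)).symm v α =
      (minorMatrix p ρ (frontal (cpTensor A B C))).col (minorEquiv I J (p + 1) (s, t)) ⬝ᵥ v := by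
    refine Fintype.sum_equiv (monEquiv h (p + 1)) _ _ fun α => ?_
    have h1 : (monReindex h (p + 1)).symm v α = v (monEquiv h (p + 1) α) := rfl
    have h2 : compSlice ρ (frontal (cpTensor A B C)) =
        fun l => diagForm A B ((mixX ρ * C) l) := funext fun l => compSlice_cpTensor ρ l
    simp only [minorMatrix, col_apply, of_apply, Equiv.symm_apply_apply, h1, h2]
  rw [this]

theorem isOrthComplBasis_momentMatrix (hpR : p + h = R) (hp : 1 ≤ p)
    (hAB : FullColumnRank (khatriRao (compound (p + 1) A) (compound (p + 1) B)))
    (hx : GoodMix p C ρ x) :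
    IsOrthComplBasis (minorMatrix p ρ (frontal (cpTensor A B C)))
      (momentMatrix hpR (p + 1) x) :=
  ⟨linearIndependent_momentMatrix_col hpR (linearIndependent_moment_succ hp hx.zeros),
    mem_span_momentMatrix_iff hpR hp hAB hx⟩

theorem det_ne_zero_of_linearIndependent_col {m : ℕ} {M : Matrix (Fin m) (Fin m) ℝ}
    (hM : LinearIndependent ℝ M.col) : M.det ≠ 0 := fun h0 => by
  obtain ⟨v, hv, h1⟩ := Matrix.exists_mulVec_eq_zero_iff.2 h0
  exact hv (Matrix.mulVec_injective_iff.2 hM (by rw [h1, mulVec_zero]))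

/-- Every computed basis of the kernel is a mixture of the symmetric powers of the points. -/
theorem IsOrthComplBasis.exists_eq_mul (hpR : p + h = R) (hp : 1 ≤ p)
    (hAB : FullColumnRank (khatriRao (compound (p + 1) A) (compound (p + 1) B)))
    (hx : GoodMix p C ρ x) {N : Matrix (Fin (numMon h (p + 1))) (Fin (numMon h p)) ℝ}
    (hN : IsOrthComplBasis (minorMatrix p ρ (frontal (cpTensor A B C))) N) :
    ∃ E : Matrix (Fin (numMon h p)) (Fin (numMon h p)) ℝ,
      E.det ≠ 0 ∧ N = momentMatrix hpR (p + 1) x * E := by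
  have hcol : ∀ j, ∃ e : Fin (numMon h p) → ℝ,
      ∑ i, e i • (momentMatrix hpR (p + 1) x).col i = N.col j := fun j =>
    (Submodule.mem_span_range_iff_exists_fun ℝ).1 <|
      (mem_span_momentMatrix_iff hpR hp hAB hx _).2 <|
        (hN.2 _).1 (Submodule.subset_span (Set.mem_range_self j))
  choose e he using hcol
  have hNE : N = momentMatrix hpR (p + 1) x * (Matrix.of e)ᵀ := by
    ext a j
    have := congrFun (he j) a
    simp only [Finset.sum_apply, Pi.smul_apply, col_apply, smul_eq_mul] at this
    rw [← this, mul_apply]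
    exact Finset.sum_congr rfl fun i _ => mul_comm _ _
  refine ⟨(Matrix.of e)ᵀ, fun h0 => ?_, hNE⟩
  obtain ⟨v, hv, h1⟩ := Matrix.exists_mulVec_eq_zero_iff.2 h0
  exact hv (Matrix.mulVec_injective_iff.2 hN.1 (by rw [hNE, ← mulVec_mulVec, h1]; simp))

/-- Contracting the power of order p + 1 of x with u gives u ⬝ᵥ x times its p-th power, so the outer
factors do not depend on u. -/
theorem pencil_momentMatrix_mul (hpR : p + h = R) (u : Fin (h + 1) → ℝ)
    (E : Matrix (Fin (numMon h p)) (Fin (numMon h p)) ℝ) :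
    pencil u (momentMatrix hpR (p + 1) x * E) = momentMatrix hpR p x *
      diagonal (fun i => u ⬝ᵥ x ((pointEquiv hpR).symm i)) * E := by
  ext b j
  rw [mul_apply]
  simp only [mul_diagonal]
  simp only [pencil, of_apply, mul_apply, momentMatrix, Equiv.symm_apply_apply, moment_cons, dotProduct, Finset.mul_sum,
    Finset.sum_mul]
  rw [Finset.sum_comm]
  exact Finset.sum_congr rfl fun i _ => Finset.sum_congr rfl fun l _ => by ring

theorem gevd_findsPoints (hpR : p + h = R) (hp : 1 ≤ p)
    (hAB : FullColumnRank (khatriRao (compound (p + 1) A) (compound (p + 1) B)))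
    (hx : GoodMix p C ρ x) {N : Matrix (Fin (numMon h (p + 1))) (Fin (numMon h p)) ℝ}
    (hN : IsOrthComplBasis (minorMatrix p ρ (frontal (cpTensor A B C))) N) :
    (∃ V F, IsGEVD (pencil (mixU (K := K) ρ) N) (pencil (mixW (K := K) ρ) N) V F) ∧
      ∀ V F, IsGEVD (pencil (mixU (K := K) ρ) N) (pencil (mixW (K := K) ρ) N) V F →
        FindsPoints x N V := by
  obtain ⟨E, hE, rfl⟩ := hN.exists_eq_mul hpR hp hAB hx
  have hX := det_ne_zero_of_linearIndependent_col
    (linearIndependent_momentMatrix_col hpR (linearIndependent_moment hx.zeros))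
  rw [pencil_momentMatrix_mul, pencil_momentMatrix_mul]
  refine ⟨exists_isGEVD hX hE fun i => hx.ne_zero _, fun V F hV Ω => ?_⟩
  obtain ⟨e, c, hc, he⟩ := hV.exists_mulVec_eq_single hX hE
    (fun i j hij => hx.separated _ _ ((pointEquiv hpR).symm.injective.ne hij)) (pointEquiv hpR Ω)
  obtain ⟨l₀, hl₀⟩ := ne_zero_of_vecMul_iff hp hx.zeros Ω
  -- The column of N * V is c times a power of the point; its entries at l ::ₛ l₀ᵖ are c (x Ω l₀)ᵖ x
  -- Ω l.
  refine ⟨(e, monEquiv h p (Sym.replicate p l₀)), c * x Ω l₀ ^ p,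
    mul_ne_zero hc (pow_ne_zero _ hl₀), ?_⟩
  ext l
  have h1 : pointVec (momentMatrix hpR (p + 1) x * E) V
      (e, monEquiv h p (Sym.replicate p l₀)) l =
      ((momentMatrix hpR (p + 1) x * E) *ᵥ V.col e)
        (monEquiv h (p + 1) (l ::ₛ Sym.replicate p l₀)) := by
    simp [pointVec, mulVec, dotProduct]
  rw [h1, ← mulVec_mulVec, he, mulVec_single]
  simp [momentMatrix, moment_cons, moment_replicate]
  ring

end Points

/-! ### The procedure -/

section Program

variable (I J K R h p : ℕ)

/-- The slices of the input tensor. -/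
def inputPoly (κ : Fin K) : Matrix (Fin I) (Fin J) (MvPolynomial Cell ℚ) := regPoly κ I J

/-- The mixing coefficients. -/
def mixPoly (a : Fin (Fintype.card (MixIndex h K))) : MvPolynomial Cell ℚ :=
  MvPolynomial.X (K, (a : ℕ), 0)

/-- The first phase: compute the points. -/
def findPoints : Procedure :=
  -- Work registers start at K + 3, clear of the input registers 0 to K and the output registers 0
  -- to 2.
  .seq (.poly (K + 3) _ _ (minorMatrix p (mixPoly K h) (inputPoly I J K))) <|
  .seq (.orthCompl (K + 4) _ _ (numMon h p) (regCells (K + 3) (numMon h (p + 1))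
    (Fintype.card (MinorIndex I J (p + 1))))) <|
  .seq (.poly (K + 5) _ _ (pencil (mixU (K := K) (mixPoly K h))
    (regPoly (K + 4) (numMon h (p + 1)) (numMon h p)))) <|
  .seq (.poly (K + 6) _ _ (pencil (mixW (K := K) (mixPoly K h))
    (regPoly (K + 4) (numMon h (p + 1)) (numMon h p)))) <|
  .gevd (K + 7) (K + 8) _ (regCells (K + 5) (numMon h p) (numMon h p))
    (regCells (K + 6) (numMon h p) (numMon h p))

/-- Copy the factor matrices to the output registers. -/
def writeOutput : Procedure :=
  .seq (.poly 0 _ _ (regPoly (K + 9) I R)) <|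
  .seq (.poly 1 _ _ (regPoly (K + 10) J R)) <|
  .poly 2 _ _ (regPoly (K + 14) K R)

/-- The second phase: try the given choices one after the other, until one of them yields a
decomposition. -/
def tryChoices : List (Fin R → TermChoice I J h p) → Procedure
  | [] => .skip
  | c :: L =>
    .seq (.poly (K + 9) _ _ (firstFactor (mixPoly K h) (inputPoly I J K)
      (regPoly (K + 4) _ _) (regPoly (K + 7) _ _) c)) <|
    .seq (.poly (K + 10) _ _ (secondFactor (mixPoly K h) (inputPoly I J K)
      (regPoly (K + 4) _ _) (regPoly (K + 7) _ _) c)) <|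
    .seq (.poly (K + 11) _ _ (khatriRaoGram (regPoly (K + 9) I R) (regPoly (K + 10) J R))) <|
    .seq (.poly (K + 12) 1 1 (Matrix.of fun _ _ => (regPoly (K + 11) R R).det)) <|
    -- A choice with singular Gram matrix is skipped, so the inversion cannot fail.
    .ifZero (K + 12, 0, 0) (tryChoices L) <|
    .seq (.inverse (K + 13) R (regCells (K + 11) R R)) <|
    .seq (.poly (K + 14) _ _ (thirdFactor (inputPoly I J K) (regPoly (K + 9) I R)
      (regPoly (K + 10) J R) (regPoly (K + 13) R R))) <|
    .seq (.poly (K + 15) 1 1 (Matrix.of fun _ _ => cpResidual (inputPoly I J K)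
      (regPoly (K + 9) I R) (regPoly (K + 10) J R) (regPoly (K + 14) K R))) <|
    .ifZero (K + 15, 0, 0) (writeOutput I J K R) (tryChoices L)

/-- The procedure that finds the decomposition. -/
def findCPD : Procedure :=
  .seq (findPoints I J K h p) (tryChoices I J K R h p Finset.univ.toList)

variable {I J K R h p}

/-- The memory still contains the input. -/
structure HasInput (T : Tensor I J K) (ρ : Fin (Fintype.card (MixIndex h K)) → ℝ)
    (σ : Memory) : Prop where
  slice : ∀ κ : Fin K, σ.read κ I J = frontal T κ
  mix : ∀ a : Fin (Fintype.card (MixIndex h K)), σ (K, (a : ℕ), 0) = ρ a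

section HasInput

variable {T : Tensor I J K} {ρ : Fin (Fintype.card (MixIndex h K)) → ℝ} {σ : Memory}

theorem hasInput_start : HasInput T ρ (Memory.start T ρ) where
  slice κ := by
    ext i j
    simp [Memory.read, Memory.start, frontal]
  mix a := by
    simp only [Memory.start, lt_irrefl, dite_false]
    exact dif_pos ⟨trivial, a.2, trivial⟩

theorem HasInput.write (hσ : HasInput T ρ σ) {y m n : ℕ} (hy : K < y)
    (M : Matrix (Fin m) (Fin n) ℝ) : HasInput T ρ (σ.write y M) where
  slice κ := by
    rw [Memory.read_write_of_ne _ (by have := κ.2; omega), hσ.slice]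
  mix a := by
    rw [Memory.write_apply_of_ne _ _ (by simp only; omega), hσ.mix]

theorem HasInput.inputPoly_map (hσ : HasInput T ρ σ) (κ : Fin K) :
    (inputPoly I J K κ).map (evalAt σ) = frontal T κ := by
  rw [inputPoly, regPoly_map, hσ.slice]

theorem HasInput.mixPoly_map (hσ : HasInput T ρ σ) (a : Fin (Fintype.card (MixIndex h K))) :
    evalAt σ (mixPoly K h a) = ρ a :=
  (MvPolynomial.aeval_X σ _).trans (hσ.mix a)

end HasInput

/-- The memory after the first phase. -/
structure HasPoints (T : Tensor I J K) (ρ : Fin (Fintype.card (MixIndex h K)) → ℝ)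
    (N : Matrix (Fin (numMon h (p + 1))) (Fin (numMon h p)) ℝ)
    (V : Matrix (Fin (numMon h p)) (Fin (numMon h p)) ℝ) (σ : Memory) : Prop
    extends HasInput T ρ σ where
  tensors : σ.read (K + 4) (numMon h (p + 1)) (numMon h p) = N
  vectors : σ.read (K + 7) (numMon h p) (numMon h p) = V

/-! ### Every execution succeeds -/

section Correctness

variable {T : Tensor I J K} {ρ : Fin (Fintype.card (MixIndex h K)) → ℝ}
  {N : Matrix (Fin (numMon h (p + 1))) (Fin (numMon h p)) ℝ}
  {V : Matrix (Fin (numMon h p)) (Fin (numMon h p)) ℝ} {σ : Memory}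

theorem HasPoints.write (hσ : HasPoints T ρ N V σ) {y m n : ℕ} (hy : K + 7 < y)
    (M : Matrix (Fin m) (Fin n) ℝ) : HasPoints T ρ N V (σ.write y M) where
  toHasInput := hσ.toHasInput.write (by omega) M
  tensors := by rw [Memory.read_write_of_ne _ (by omega), hσ.tensors]
  vectors := by rw [Memory.read_write_of_ne _ (by omega), hσ.vectors]

theorem writeOutput_ensures {A : Matrix (Fin I) (Fin R) ℝ} {B : Matrix (Fin J) (Fin R) ℝ}
    {C : Matrix (Fin K) (Fin R) ℝ} (hA : σ.read (K + 9) I R = A) (hB : σ.read (K + 10) J R = B)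
    (hC : σ.read (K + 14) K R = C) (hT : IsCPD A B C T) :
    (writeOutput I J K R).Ensures
      (fun σ => IsCPD (σ.read 0 I R) (σ.read 1 J R) (σ.read 2 K R) T) σ := by
  simp only [writeOutput, Procedure.Ensures, map_aeval, regPoly_map]
  rw [Memory.read_write_of_ne _ (by omega), Memory.read_write_of_ne _ (by omega),
    Memory.read_write_self, Memory.read_write_of_ne _ (by omega), Memory.read_write_self,
    Memory.read_write_self, Memory.read_write_of_ne _ (by omega), hA,
    Memory.read_write_of_ne _ (by omega), hB, Memory.read_write_of_ne _ (by omega),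
    hC]
  exact hT

/-- Any choice that passes the residual test gives a CPD, since the rank is known to be R. A
rejected choice is not good, so a good one remains in the tail and the empty list is never reached.
-/
theorem tryChoices_ensures (hR : tensorRank T = R) (L : List (Fin R → TermChoice I J h p))
    (hσ : HasPoints T ρ N V σ)
    (hL : ∃ c ∈ L, GoodFactors T (firstFactor ρ (frontal T) N V c)
      (secondFactor ρ (frontal T) N V c)) :
    (tryChoices I J K R h p L).Ensures
      (fun σ => IsCPD (σ.read 0 I R) (σ.read 1 J R) (σ.read 2 K R) T) σ := by
  induction L generalizing σ with
  | nil => simp at hL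
  | cons c L ih =>
    set A := firstFactor ρ (frontal T) N V c with hAdef
    set B := secondFactor ρ (frontal T) N V c with hBdef
    have hrest : ¬ GoodFactors T A B → ∃ c ∈ L, GoodFactors T (firstFactor ρ (frontal T) N V c)
        (secondFactor ρ (frontal T) N V c) := by
      intro hbad
      obtain ⟨c', hc', hg⟩ := hL
      rcases List.mem_cons.1 hc' with rfl | hc'
      · exact absurd hg hbad
      · exact ⟨c', hc', hg⟩
    simp only [tryChoices, Procedure.Ensures, map_aeval]
    have e1 : (firstFactor (mixPoly K h) (inputPoly I J K)
        (regPoly (K + 4) _ _) (regPoly (K + 7) _ _) c).map (evalAt σ) = A := by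
      simp only [map_firstFactor, regPoly_map, hσ.inputPoly_map, hσ.mixPoly_map, hσ.tensors,
        hσ.vectors, hAdef]
    rw [e1]
    have hσ1 := hσ.write (y := K + 9) (by omega) A
    have hA1 := σ.read_write_self (K + 9) A
    generalize σ.write (K + 9) A = σ1 at hσ1 hA1 ⊢
    have e2 : (secondFactor (mixPoly K h) (inputPoly I J K)
        (regPoly (K + 4) _ _) (regPoly (K + 7) _ _) c).map (evalAt σ1) = B := by
      simp only [map_secondFactor, regPoly_map, hσ1.inputPoly_map, hσ1.mixPoly_map, hσ1.tensors,
        hσ1.vectors, hBdef]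
    rw [e2]
    have hσ2 := hσ1.write (y := K + 10) (by omega) B
    have hA2 := (σ1.read_write_of_ne (x := K + 10) (y := K + 9) (by omega) B).trans hA1
    have hB2 := σ1.read_write_self (K + 10) B
    generalize σ1.write (K + 10) B = σ2 at hσ2 hA2 hB2 ⊢
    rw [map_khatriRaoGram, regPoly_map, regPoly_map, hA2, hB2]
    have hσ3 := hσ2.write (y := K + 11) (by omega) (khatriRaoGram A B)
    have hA3 := (σ2.read_write_of_ne (x := K + 11) (y := K + 9) (by omega)
      (khatriRaoGram A B)).trans hA2
    have hB3 := (σ2.read_write_of_ne (x := K + 11) (y := K + 10) (by omega)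
      (khatriRaoGram A B)).trans hB2
    have hG3 := σ2.read_write_self (K + 11) (khatriRaoGram A B)
    generalize σ2.write (K + 11) (khatriRaoGram A B) = σ3 at hσ3 hA3 hB3 hG3 ⊢
    have e4 : (Matrix.of fun (_ _ : Fin 1) => (regPoly (K + 11) R R).det).map (evalAt σ3) =
        Matrix.of fun _ _ => (khatriRaoGram A B).det := by
      ext i j
      rw [map_apply, of_apply, RingHom.map_det, RingHom.mapMatrix_apply, regPoly_map, hG3]
      rfl
    rw [e4]
    set D : Matrix (Fin 1) (Fin 1) ℝ := Matrix.of fun _ _ => (khatriRaoGram A B).det with hD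
    have hσ4 := hσ3.write (y := K + 12) (by omega) D
    have hA4 := (σ3.read_write_of_ne (x := K + 12) (y := K + 9) (by omega) D).trans hA3
    have hB4 := (σ3.read_write_of_ne (x := K + 12) (y := K + 10) (by omega) D).trans hB3
    have hG4 := (σ3.read_write_of_ne (x := K + 12) (y := K + 11) (by omega) D).trans hG3
    have hD4 : σ3.write (K + 12) D (K + 12, 0, 0) = (khatriRaoGram A B).det :=
      σ3.write_apply_self (K + 12) D 0 0
    generalize σ3.write (K + 12) D = σ4 at hσ4 hA4 hB4 hG4 hD4 ⊢
    rw [hD4]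
    refine ⟨fun h0 => ih hσ4 (hrest fun hg => hg.1.det_khatriRaoGram_ne_zero h0), fun hne => ?_⟩
    rw [regCells_map, hG4]
    refine ⟨hne, ?_⟩
    set H := (khatriRaoGram A B)⁻¹ with hH
    have hσ5 := hσ4.write (y := K + 13) (by omega) H
    have hA5 := (σ4.read_write_of_ne (x := K + 13) (y := K + 9) (by omega) H).trans hA4
    have hB5 := (σ4.read_write_of_ne (x := K + 13) (y := K + 10) (by omega) H).trans hB4
    have hH5 := σ4.read_write_self (K + 13) H
    generalize σ4.write (K + 13) H = σ5 at hσ5 hA5 hB5 hH5 ⊢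
    have e6 : (thirdFactor (inputPoly I J K) (regPoly (K + 9) I R)
        (regPoly (K + 10) J R) (regPoly (K + 13) R R)).map (evalAt σ5) =
        thirdFactor (frontal T) A B H := by
      simp only [map_thirdFactor, regPoly_map, hσ5.inputPoly_map, hA5, hB5, hH5]
    rw [e6]
    set C := thirdFactor (frontal T) A B H with hCdef
    have hσ6 := hσ5.write (y := K + 14) (by omega) C
    have hA6 := (σ5.read_write_of_ne (x := K + 14) (y := K + 9) (by omega) C).trans hA5
    have hB6 := (σ5.read_write_of_ne (x := K + 14) (y := K + 10) (by omega) C).trans hB5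
    have hC6 := σ5.read_write_self (K + 14) C
    generalize σ5.write (K + 14) C = σ6 at hσ6 hA6 hB6 hC6 ⊢
    have e7 : (Matrix.of fun (_ _ : Fin 1) => cpResidual (inputPoly I J K) (regPoly (K + 9) I R)
        (regPoly (K + 10) J R) (regPoly (K + 14) K R)).map (evalAt σ6) =
        Matrix.of fun _ _ => cpResidual (frontal T) A B C := by
      ext i j
      simp only [map_apply, of_apply, map_cpResidual, regPoly_map, hσ6.inputPoly_map, hA6, hB6,
        hC6]
    rw [e7]
    set W : Matrix (Fin 1) (Fin 1) ℝ := Matrix.of fun _ _ => cpResidual (frontal T) A B C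
    have hσ7 := hσ6.write (y := K + 15) (by omega) W
    have hA7 := (σ6.read_write_of_ne (x := K + 15) (y := K + 9) (by omega) W).trans hA6
    have hB7 := (σ6.read_write_of_ne (x := K + 15) (y := K + 10) (by omega) W).trans hB6
    have hC7 := (σ6.read_write_of_ne (x := K + 15) (y := K + 14) (by omega) W).trans hC6
    have hW7 : σ6.write (K + 15) W (K + 15, 0, 0) = cpResidual (frontal T) A B C :=
      σ6.write_apply_self (K + 15) W 0 0
    generalize σ6.write (K + 15) W = σ7 at hσ7 hA7 hB7 hC7 hW7 ⊢
    rw [hW7]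
    refine ⟨fun h0 => writeOutput_ensures hA7 hB7 hC7 ⟨(cpResidual_eq_zero_iff T).1 h0, hR⟩,
      fun hne => ih hσ7 (hrest fun hg => hne hg.residual_eq_zero)⟩

theorem findPoints_ensures {A : Matrix (Fin I) (Fin R) ℝ} {B : Matrix (Fin J) (Fin R) ℝ}
    {C : Matrix (Fin K) (Fin R) ℝ} {x : {S : Finset (Fin R) // #S = p} → Fin (h + 1) → ℝ}
    (hpR : p + h = R) (hp : 1 ≤ p)
    (hAB : FullColumnRank (khatriRao (compound (p + 1) A) (compound (p + 1) B)))
    (hx : GoodMix p C ρ x) (hσ : HasInput (cpTensor A B C) ρ σ) :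
    (findPoints I J K h p).Ensures
      (fun σ => ∃ N V, HasPoints (cpTensor A B C) ρ N V σ ∧ FindsPoints x N V) σ := by
  simp only [findPoints, Procedure.Ensures, map_aeval]
  have e1 : (minorMatrix p (mixPoly K h) (inputPoly I J K)).map (evalAt σ) =
      minorMatrix p ρ (frontal (cpTensor A B C)) := by
    simp only [map_minorMatrix, hσ.inputPoly_map, hσ.mixPoly_map]
  rw [e1]
  set Q := minorMatrix p ρ (frontal (cpTensor A B C)) with hQ
  have hσ1 := hσ.write (y := K + 3) (by omega) Q
  have hQ1 := σ.read_write_self (K + 3) Q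
  generalize σ.write (K + 3) Q = σ1 at hσ1 hQ1 ⊢
  rw [regCells_map, hQ1]
  -- The powers of the points show that the complement has the prescribed dimension.
  refine ⟨⟨_, isOrthComplBasis_momentMatrix hpR hp hAB hx⟩, fun N hN => ?_⟩
  obtain ⟨hex, hall⟩ := gevd_findsPoints hpR hp hAB hx hN
  have hσ2 := hσ1.write (y := K + 4) (by omega) N
  have hN2 := σ1.read_write_self (K + 4) N
  generalize σ1.write (K + 4) N = σ2 at hσ2 hN2 ⊢
  have e3 : (pencil (mixU (K := K) (mixPoly K h)) (regPoly (K + 4) (numMon h (p + 1))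
      (numMon h p))).map (evalAt σ2) = pencil (mixU (K := K) ρ) N := by
    simp only [map_pencil, regPoly_map, mixU, hσ2.mixPoly_map, hN2]
    rfl
  rw [e3]
  set U := pencil (mixU (K := K) ρ) N with hU
  have hσ3 := hσ2.write (y := K + 5) (by omega) U
  have hN3 := (σ2.read_write_of_ne (x := K + 5) (y := K + 4) (by omega) U).trans hN2
  have hU3 := σ2.read_write_self (K + 5) U
  generalize σ2.write (K + 5) U = σ3 at hσ3 hN3 hU3 ⊢
  have e4 : (pencil (mixW (K := K) (mixPoly K h)) (regPoly (K + 4) (numMon h (p + 1))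
      (numMon h p))).map (evalAt σ3) = pencil (mixW (K := K) ρ) N := by
    simp only [map_pencil, regPoly_map, mixW, hσ3.mixPoly_map, hN3]
    rfl
  rw [e4]
  set W := pencil (mixW (K := K) ρ) N with hW
  have hσ4 := hσ3.write (y := K + 6) (by omega) W
  have hN4 := (σ3.read_write_of_ne (x := K + 6) (y := K + 4) (by omega) W).trans hN3
  have hU4 := (σ3.read_write_of_ne (x := K + 6) (y := K + 5) (by omega) W).trans hU3
  have hW4 := σ3.read_write_self (K + 6) W
  generalize σ3.write (K + 6) W = σ4 at hσ4 hN4 hU4 hW4 ⊢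
  rw [regCells_map, regCells_map, hU4, hW4]
  refine ⟨hex, fun V F hV => ⟨N, V, ⟨(hσ4.write (by omega) V).write (by omega) F, ?_, ?_⟩,
    hall V F hV⟩⟩
  · rw [Memory.read_write_of_ne _ (by omega), Memory.read_write_of_ne _ (by omega), hN4]
  · rw [Memory.read_write_of_ne _ (by omega), Memory.read_write_self]

end Correctness

theorem cpdFoundAlgebraically (hpR : p + h = R) (hp : 1 ≤ p) (hh : 1 ≤ h) :
    CPDFoundAlgebraically I J K R
      {T | ∃ (A : Matrix (Fin I) (Fin R) ℝ) (B : Matrix (Fin J) (Fin R) ℝ)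
          (C : Matrix (Fin K) (Fin R) ℝ),
        kRank C = h + 1 ∧
          FullColumnRank (khatriRao (compound (p + 1) A) (compound (p + 1) B)) ∧
            T = cpTensor A B C} := by
  refine ⟨Fintype.card (MixIndex h K), findCPD I J K R h p, ?_⟩
  rintro T ⟨A, B, C, hk, hAB, rfl⟩
  filter_upwards [ae_goodMix hpR hp C fun f hf => linearIndependent_of_kRank hk hf] with ρ hρ
  obtain ⟨x, hx⟩ := hρ
  refine Procedure.Ensures.mono (P := findPoints I J K h p) (fun σ hσ => ?_)
    (findPoints_ensures hpR hp hAB hx hasInput_start)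
  obtain ⟨N, V, hNV, hfind⟩ := hσ
  obtain ⟨c, hc⟩ := exists_goodFactors hpR hp hh hAB hx.zeros hfind
  exact tryChoices_ensures (tensorRank_cpTensor hpR hp hh hk hAB) _ hNV ⟨c, by simp, hc⟩

end Program

end

theorem theorem1p7 (I J K R k n : ℕ) (hn : n + k = R + 2) (hnR : n ≤ R) :
    (∀ (A : Matrix (Fin I) (Fin R) ℝ) (B : Matrix (Fin J) (Fin R) ℝ)
        (C : Matrix (Fin K) (Fin R) ℝ),
      kRank C = k → FullColumnRank (khatriRao (compound n A) (compound n B)) →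
        tensorRank (cpTensor A B C) = R ∧ CPDUnique (cpTensor A B C)) ∧
    CPDFoundAlgebraically I J K R
      {T | ∃ (A : Matrix (Fin I) (Fin R) ℝ) (B : Matrix (Fin J) (Fin R) ℝ)
          (C : Matrix (Fin K) (Fin R) ℝ),
        kRank C = k ∧ FullColumnRank (khatriRao (compound n A) (compound n B)) ∧
          T = cpTensor A B C} := by
  -- For k > R the class is empty, as a k-rank is at most R. Otherwise k ≤ R gives p ≥ 1, and n ≤ R
  -- gives h ≥ 1.
  by_cases hkR : k ≤ R
  · obtain ⟨h, rfl⟩ : ∃ h, k = h + 1 := ⟨k - 1, by omega⟩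
    obtain ⟨p, rfl⟩ : ∃ p, n = p + 1 := ⟨n - 1, by omega⟩
    have hpR : p + h = R := by omega
    have hp : 1 ≤ p := by omega
    have hh : 1 ≤ h := by omega
    exact ⟨fun A B C hk hAB => ⟨tensorRank_cpTensor hpR hp hh hk hAB,
      cpdUnique_cpTensor hpR hp hh hk hAB⟩, cpdFoundAlgebraically hpR hp hh⟩
  · refine ⟨fun A B C hk => absurd (hk ▸ kRank_le C) hkR, 0, .skip, ?_⟩
    rintro T ⟨A, B, C, hk, -⟩
    exact absurd (hk ▸ kRank_le C) hkR
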